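/- Let $n\ge 1$ and $p\ge 1$ be integers and let $a\ge 1$, $\alpha>1$ be real numbers with $2p<n+2a$. Write $$\widetilde\Delta_{n+1,a}=\sum_{i=1}^{n+1}\partial_{x_i}^2+\frac{2a-1}{x_{n+1}}\,\partial_{x_{n+1}},$$ acting on functions $f$ on $\mathbb R^{n+1}$ that are of class $C^2$ and even in $x_{n+1}$, where on the hyperplane $\{x_{n+1}=0\}$ the quotient $\frac{1}{x_{n+1}}\partial_{x_{n+1}}f$ is understood as its continuous extension $\partial_{x_{n+1}}^2 f$. Let $u\in C^{2p}(\mathbb R^{n+1})$ be positive everywhere, even in $x_{n+1}$, and satisfy $$(-\widetilde\Delta_{n+1,a})^p u=u^\alpha\quad\text{in }\mathbb R^{n+1}.$$ Then $$(-\widetilde\Delta_{n+1,a})^i u>0\quad\text{in }\mathbb R^{n+1}\quad\text{for every } i=1,\dots,p-1.$$ -/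

import Mathlib

open scoped Laplacian

noncomputable section

namespace WeightedLaplacian

/-- The reflection `(x₁, …, xₙ, xₙ₊₁) ↦ (x₁, …, xₙ, -xₙ₊₁)` of `ℝⁿ⁺¹`. -/
def reflectLast {n : ℕ} (x : EuclideanSpace ℝ (Fin (n + 1))) : EuclideanSpace ℝ (Fin (n + 1)) :=
  WithLp.toLp 2 (Function.update (fun i => x i) (Fin.last n) (-x (Fin.last n)))

/-- `f` is even with respect to the last variable. -/
def EvenInLast {n : ℕ} (f : EuclideanSpace ℝ (Fin (n + 1)) → ℝ) : Prop :=
  ∀ x, f (reflectLast x) = f x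

/-- The partial derivative `∂f/∂xₙ₊₁`. -/
def partialLast {n : ℕ} (f : EuclideanSpace ℝ (Fin (n + 1)) → ℝ) :
    EuclideanSpace ℝ (Fin (n + 1)) → ℝ :=
  fun x => lineDeriv ℝ f x (EuclideanSpace.single (Fin.last n) (1 : ℝ))

/-- The function `(1 / xₙ₊₁) ∂f/∂xₙ₊₁` on `ℝⁿ⁺¹`, for `f` of class `C²` and even in `xₙ₊₁`. On the
hyperplane `xₙ₊₁ = 0`, where `∂f/∂xₙ₊₁` vanishes, the quotient is read as its continuous extension,
which is `∂²f/∂xₙ₊₁²`. -/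
def singularTerm {n : ℕ} (f : EuclideanSpace ℝ (Fin (n + 1)) → ℝ) :
    EuclideanSpace ℝ (Fin (n + 1)) → ℝ :=
  fun x =>
    if x (Fin.last n) = 0 then partialLast (partialLast f) x
    else partialLast f x / x (Fin.last n)

/-- The operator `-(Δ + ((2a - 1) / xₙ₊₁) ∂/∂xₙ₊₁)` on functions on `ℝⁿ⁺¹` that are even in
`xₙ₊₁`. Its iterates, in the sense of `Nat.iterate`, are its powers. -/
def negWeightedLaplacian {n : ℕ} (a : ℝ) (f : EuclideanSpace ℝ (Fin (n + 1)) → ℝ) :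
    EuclideanSpace ℝ (Fin (n + 1)) → ℝ :=
  fun x => -(Δ f x + (2 * a - 1) * singularTerm f x)

end WeightedLaplacian

end

/-! Write `L` for `negWeightedLaplacian a`, `D = n + 2a` and `w = |xₙ₊₁|^(2a-1)`. The operator `L`
is symmetric for `w dx` and behaves like `-Δ` in dimension `D`. The proof descends on `i`: since `Lᵖ
u = u^α > 0`, it suffices that `v = Lⁱ u` is positive whenever `L v > 0`.

Centred at any `x₀`, take the test functions `ψ_lam`, the Bessel translates of `(1 - lam |x|²)₊ᵏ`.
Translation intertwines `L` with the radial Laplacian in dimension `D`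
(`negWeightedLaplacian_besselMean`), so the averages `lam^(D/2) ∫ v ψ_lam w` of a superharmonic `v`
increase with `lam`, that is, decrease as the radius `lam^(-1/2)` grows
(`monotoneOn_rpow_mul_integral_scaledCutoff`). If they tend to `0` as `lam → 0`, they are all
nonnegative; letting the test function concentrate gives `v x₀ ≥ 0`, and a zero would be a minimum,
where `L v ≤ 0` (`pos_of_tendsto_integral_scaledCutoff`).

The decay (`tendsto_integral_iterate_mul_scaledCutoff`) is the rescaled test function method. Moving
`Lʲ` onto `ψ_lam` yields a factor `lam^j`, and Young's inequality bounds the rest by `½ ∫ u^α ψ_lam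
w` plus a multiple of the mass of a ball, which is `O(lam^(-D/2))`. For `j = p` the equation lets
the half be absorbed, which controls `∫ u^α ψ_lam w`; for `1 ≤ j ≤ p` the normalized average is then
`O(lam)`. -/

open MeasureTheory Set Filter Topology
open scoped Laplacian

/-! ### Parametric integrals over compact sets -/

/-- Differentiation under an integral over a compact set, for jointly continuous derivatives. -/
theorem hasFDerivAt_setIntegral_of_isCompact {H T E : Type*} [NormedAddCommGroup H]
    [NormedSpace ℝ H] [LocallyCompactSpace H] [TopologicalSpace T] [MeasurableSpace T]
    [OpensMeasurableSpace T] [SecondCountableTopology T] [T2Space T]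
    [NormedAddCommGroup E] [NormedSpace ℝ E]
    {μ : Measure T} [IsFiniteMeasureOnCompacts μ] {K : Set T} (hK : IsCompact K)
    {F : H → T → E} {F' : H → T → H →L[ℝ] E}
    (hF : ∀ x, Continuous (F x)) (hF' : Continuous fun z : H × T => F' z.1 z.2)
    (hd : ∀ x t, HasFDerivAt (fun y => F y t) (F' x t) x) (x₀ : H) :
    HasFDerivAt (fun x => ∫ t in K, F x t ∂μ) (∫ t in K, F' x₀ t ∂μ) x₀ := by
  obtain ⟨s, hs, hsx⟩ := exists_compact_mem_nhds x₀
  obtain ⟨C, hC⟩ := (hs.prod hK).exists_bound_of_continuousOn hF'.continuousOn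
  refine hasFDerivAt_integral_of_dominated_of_fderiv_le (μ := μ.restrict K) (F := F) (F' := F')
    (bound := fun _ => C) hsx
    (Eventually.of_forall fun x => (hF x).aestronglyMeasurable)
    ((hF x₀).continuousOn.integrableOn_compact hK) ?_ ?_ ?_ ?_
  · exact (hF'.comp (by fun_prop : Continuous fun t : T => (x₀, t))).continuousOn
      |>.aestronglyMeasurable_of_isCompact hK hK.measurableSet
  · filter_upwards [ae_restrict_mem hK.measurableSet] with t ht x hx
    exact hC (x, t) ⟨hx, ht⟩
  · exact continuousOn_const.integrableOn_compact hK
  · exact Eventually.of_forall fun t x _ => hd x t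

theorem hasDerivAt_setIntegral_of_isCompact {T : Type*} [TopologicalSpace T] [MeasurableSpace T]
    [OpensMeasurableSpace T] [SecondCountableTopology T] [T2Space T]
    {μ : Measure T} [IsFiniteMeasureOnCompacts μ] {K : Set T} (hK : IsCompact K)
    {F : ℝ → T → ℝ} {F' : ℝ → T → ℝ}
    (hF : ∀ x, Continuous (F x)) (hF' : Continuous fun z : ℝ × T => F' z.1 z.2)
    (hd : ∀ x t, HasDerivAt (fun y => F y t) (F' x t) x) (x₀ : ℝ) :
    HasDerivAt (fun x => ∫ t in K, F x t ∂μ) (∫ t in K, F' x₀ t ∂μ) x₀ := by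
  obtain ⟨C, hC⟩ := ((isCompact_closedBall x₀ 1).prod hK).exists_bound_of_continuousOn
    hF'.continuousOn
  refine (hasDerivAt_integral_of_dominated_loc_of_deriv_le (μ := μ.restrict K) (F := F) (F' := F')
    (bound := fun _ => C) (Metric.closedBall_mem_nhds x₀ one_pos)
    (Eventually.of_forall fun x => (hF x).aestronglyMeasurable)
    ((hF x₀).continuousOn.integrableOn_compact hK) ?_ ?_ ?_ ?_).2
  · exact (hF'.comp (by fun_prop : Continuous fun t : T => (x₀, t))).continuousOn
      |>.aestronglyMeasurable_of_isCompact hK hK.measurableSet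
  · filter_upwards [ae_restrict_mem hK.measurableSet] with t ht x hx
    exact hC (x, t) ⟨hx, ht⟩
  · exact continuousOn_const.integrableOn_compact hK
  · exact Eventually.of_forall fun t x _ => hd x t

theorem hasFDerivAt_intervalIntegral_param {H E : Type*} [NormedAddCommGroup H]
    [NormedSpace ℝ H] [LocallyCompactSpace H] [NormedAddCommGroup E] [NormedSpace ℝ E]
    {a b : ℝ} (hab : a ≤ b) {F : H → ℝ → E} {F' : H → ℝ → H →L[ℝ] E}
    (hF : ∀ x, Continuous (F x)) (hF' : Continuous fun z : H × ℝ => F' z.1 z.2)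
    (hd : ∀ x t, HasFDerivAt (fun y => F y t) (F' x t) x) (x₀ : H) :
    HasFDerivAt (fun x => ∫ t in a..b, F x t) (∫ t in a..b, F' x₀ t) x₀ := by
  simp only [intervalIntegral.integral_of_le hab, ← integral_Icc_eq_integral_Ioc]
  exact hasFDerivAt_setIntegral_of_isCompact isCompact_Icc hF hF' hd x₀

theorem hasDerivAt_intervalIntegral_param {a b : ℝ} (hab : a ≤ b) {F F' : ℝ → ℝ → ℝ}
    (hF : ∀ x, Continuous (F x)) (hF' : Continuous fun z : ℝ × ℝ => F' z.1 z.2)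
    (hd : ∀ x t, HasDerivAt (fun y => F y t) (F' x t) x) (x₀ : ℝ) :
    HasDerivAt (fun x => ∫ t in a..b, F x t) (∫ t in a..b, F' x₀ t) x₀ := by
  simp only [intervalIntegral.integral_of_le hab, ← integral_Icc_eq_integral_Ioc]
  exact hasDerivAt_setIntegral_of_isCompact isCompact_Icc hF hF' hd x₀

/-- A parametric integral against a continuous weight is as smooth as its integrand. -/
theorem contDiff_intervalIntegral_param {a b : ℝ} (hab : a ≤ b) {k : ℝ → ℝ} (hk : Continuous k)
    (m : ℕ) {H E : Type} [NormedAddCommGroup H] [NormedSpace ℝ H] [LocallyCompactSpace H]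
    [NormedAddCommGroup E] [NormedSpace ℝ E] {F : H → ℝ → E}
    (hF : ContDiff ℝ m fun z : H × ℝ => F z.1 z.2) :
    ContDiff ℝ m fun x => ∫ t in a..b, k t • F x t := by
  -- The derivative takes values in `H →L[ℝ] E`, so the codomain has to vary in the induction.
  induction m generalizing E with
  | zero =>
    rw [Nat.cast_zero, contDiff_zero] at hF ⊢
    exact intervalIntegral.continuous_parametric_intervalIntegral_of_continuous'
      (f := fun x t => k t • F x t) (by unfold Function.uncurry; fun_prop) a b
  | succ m ih =>
    have hd : ∀ z : H × ℝ, HasFDerivAt (fun y => F y z.2)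
        ((fderiv ℝ (fun z : H × ℝ => F z.1 z.2) z).comp (ContinuousLinearMap.inl ℝ H ℝ)) z.1 := by
      intro z
      have h1 : HasFDerivAt (fun z : H × ℝ => F z.1 z.2) (fderiv ℝ (fun z : H × ℝ => F z.1 z.2) z)
          (z.1, z.2) := (hF.differentiable (by simp) z).hasFDerivAt
      exact HasFDerivAt.comp (f := fun y : H => (y, z.2)) z.1 h1 (hasFDerivAt_prodMk_left z.1 z.2)
    have hF'c : ContDiff ℝ m fun z : H × ℝ =>
        (fderiv ℝ (fun z : H × ℝ => F z.1 z.2) z).comp (ContinuousLinearMap.inl ℝ H ℝ) :=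
      (hF.fderiv_right (by simp)).clm_comp contDiff_const
    rw [Nat.cast_add, Nat.cast_one, contDiff_succ_iff_hasFDerivAt]
    refine ⟨fun x => ∫ t in a..b, k t • ((fderiv ℝ (fun z : H × ℝ => F z.1 z.2) (x, t)).comp
      (ContinuousLinearMap.inl ℝ H ℝ)), ih hF'c, fun x => ?_⟩
    have hFc := hF.continuous
    have hF'cc := hF'c.continuous
    refine hasFDerivAt_intervalIntegral_param hab (F := fun x t => k t • F x t)
      (F' := fun x t => k t • ((fderiv ℝ (fun z : H × ℝ => F z.1 z.2) (x, t)).comp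
      (ContinuousLinearMap.inl ℝ H ℝ))) (fun x => ?_) ?_ (fun x t => (hd (x, t)).const_smul _) x
    · exact hk.smul (hFc.comp (by fun_prop : Continuous fun t : ℝ => (x, t)))
    · exact (hk.comp continuous_snd).smul hF'cc

namespace WeightedLaplacian

variable {n : ℕ}

/-! ### Coordinate derivatives, evenness and regularity of the operator -/

/-- The `i`-th coordinate derivative. -/
noncomputable def partialD (i : Fin (n + 1)) (f : EuclideanSpace ℝ (Fin (n + 1)) → ℝ) :
    EuclideanSpace ℝ (Fin (n + 1)) → ℝ :=
  fun x => fderiv ℝ f x (EuclideanSpace.single i 1)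

theorem contDiff_partialD (i : Fin (n + 1)) {f : EuclideanSpace ℝ (Fin (n + 1)) → ℝ} {m : ℕ}
    (hf : ContDiff ℝ (m + 1 : ℕ) f) : ContDiff ℝ m (partialD i f) :=
  (hf.fderiv_right (by simp)).clm_apply contDiff_const

theorem partialLast_eq_partialD {f : EuclideanSpace ℝ (Fin (n + 1)) → ℝ}
    (hf : Differentiable ℝ f) : partialLast f = partialD (Fin.last n) f :=
  funext fun x => (hf x).lineDeriv_eq_fderiv

theorem laplacian_eq_sum_partialD {f : EuclideanSpace ℝ (Fin (n + 1)) → ℝ}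
    (hf : ContDiff ℝ (2 : ℕ) f) (x : EuclideanSpace ℝ (Fin (n + 1))) :
    Δ f x = ∑ i, partialD i (partialD i f) x := by
  rw [InnerProductSpace.laplacian_eq_iteratedFDeriv_orthonormalBasis f
    (EuclideanSpace.basisFun (Fin (n + 1)) ℝ)]
  refine Finset.sum_congr rfl fun i _ => ?_
  have h : DifferentiableAt ℝ (fderiv ℝ f) x :=
    (hf.fderiv_right (m := 1) (by norm_num)).differentiable (by simp) x
  simp only [iteratedFDeriv_two_apply, EuclideanSpace.basisFun_apply]
  unfold partialD
  rw [fderiv_clm_apply h (differentiableAt_const _)]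
  simp

theorem reflectLast_apply_last (x : EuclideanSpace ℝ (Fin (n + 1))) :
    reflectLast x (Fin.last n) = -x (Fin.last n) := by
  simp [reflectLast]

theorem reflectLast_apply_of_ne (x : EuclideanSpace ℝ (Fin (n + 1))) {i : Fin (n + 1)}
    (hi : i ≠ Fin.last n) : reflectLast x i = x i := by
  simp [reflectLast, hi]

theorem reflectLast_reflectLast (x : EuclideanSpace ℝ (Fin (n + 1))) :
    reflectLast (reflectLast x) = x := by
  ext i
  by_cases hi : i = Fin.last n
  · subst hi; simp [reflectLast_apply_last]
  · simp [reflectLast_apply_of_ne _ hi]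

/-- The reflection as a continuous linear map. -/
noncomputable def reflectLastCLM (n : ℕ) :
    EuclideanSpace ℝ (Fin (n + 1)) →L[ℝ] EuclideanSpace ℝ (Fin (n + 1)) :=
  LinearMap.toContinuousLinearMap
    { toFun := reflectLast
      map_add' := fun x y => by
        ext i
        by_cases hi : i = Fin.last n
        · subst hi; simp [reflectLast_apply_last]; ring
        · simp [reflectLast_apply_of_ne _ hi]
      map_smul' := fun c x => by
        ext i
        by_cases hi : i = Fin.last n
        · subst hi; simp [reflectLast_apply_last]
        · simp [reflectLast_apply_of_ne _ hi] }

theorem reflectLastCLM_apply (x : EuclideanSpace ℝ (Fin (n + 1))) :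
    reflectLastCLM n x = reflectLast x := rfl

theorem norm_reflectLast (x : EuclideanSpace ℝ (Fin (n + 1))) : ‖reflectLast x‖ = ‖x‖ := by
  rw [EuclideanSpace.norm_eq, EuclideanSpace.norm_eq]
  congr 1
  refine Finset.sum_congr rfl fun i _ => ?_
  by_cases hi : i = Fin.last n
  · subst hi; simp [reflectLast_apply_last]
  · simp [reflectLast_apply_of_ne _ hi]

theorem reflectLast_single_of_ne {i : Fin (n + 1)} (hi : i ≠ Fin.last n) :
    reflectLast (EuclideanSpace.single i (1 : ℝ)) = EuclideanSpace.single i 1 := by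
  ext j
  by_cases hj : j = Fin.last n
  · subst hj; simp [reflectLast_apply_last, Ne.symm hi]
  · simp [reflectLast_apply_of_ne _ hj]

theorem reflectLast_single_last :
    reflectLast (EuclideanSpace.single (Fin.last n) (1 : ℝ)) =
      -EuclideanSpace.single (Fin.last n) 1 := by
  ext j
  by_cases hj : j = Fin.last n
  · subst hj; simp [reflectLast_apply_last]
  · simp [reflectLast_apply_of_ne _ hj, hj]

theorem fderiv_comp_reflectLast {f : EuclideanSpace ℝ (Fin (n + 1)) → ℝ}
    (hf : Differentiable ℝ f) (x v : EuclideanSpace ℝ (Fin (n + 1))) :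
    fderiv ℝ (fun y => f (reflectLast y)) x v = fderiv ℝ f (reflectLast x) (reflectLast v) := by
  have h : HasFDerivAt (fun y => f (reflectLast y))
      ((fderiv ℝ f (reflectLast x)).comp (reflectLastCLM n)) x :=
    HasFDerivAt.comp (f := reflectLast) x (hf _).hasFDerivAt (reflectLastCLM n).hasFDerivAt
  rw [h.fderiv]; rfl

theorem EvenInLast.partialD_of_ne {f : EuclideanSpace ℝ (Fin (n + 1)) → ℝ}
    (hf : Differentiable ℝ f) (he : EvenInLast f) {i : Fin (n + 1)} (hi : i ≠ Fin.last n) :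
    EvenInLast (partialD i f) := fun x => by
  have h := fderiv_comp_reflectLast hf x (EuclideanSpace.single i 1)
  rw [reflectLast_single_of_ne hi, funext he] at h
  exact h.symm

theorem EvenInLast.partialD_last_reflectLast {f : EuclideanSpace ℝ (Fin (n + 1)) → ℝ}
    (hf : Differentiable ℝ f) (he : EvenInLast f) (x : EuclideanSpace ℝ (Fin (n + 1))) :
    partialD (Fin.last n) f (reflectLast x) = -partialD (Fin.last n) f x := by
  have h := fderiv_comp_reflectLast hf x (EuclideanSpace.single (Fin.last n) 1)
  rw [reflectLast_single_last, funext he, map_neg] at h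
  unfold partialD
  linarith

theorem EvenInLast.partialD_last_partialD_last {f : EuclideanSpace ℝ (Fin (n + 1)) → ℝ}
    (hf : ContDiff ℝ (2 : ℕ) f) (he : EvenInLast f) :
    EvenInLast (partialD (Fin.last n) (partialD (Fin.last n) f)) := fun x => by
  have hd : Differentiable ℝ (partialD (Fin.last n) f) :=
    (contDiff_partialD (m := 1) _ hf).differentiable (by simp)
  have h := fderiv_comp_reflectLast hd x (EuclideanSpace.single (Fin.last n) 1)
  rw [reflectLast_single_last,
    funext (he.partialD_last_reflectLast (hf.differentiable (by simp))), map_neg] at h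
  simp only [fderiv_fun_neg, neg_apply] at h
  unfold partialD at h ⊢
  linarith

theorem EvenInLast.partialD_last_eq_zero {f : EuclideanSpace ℝ (Fin (n + 1)) → ℝ}
    (hf : Differentiable ℝ f) (he : EvenInLast f) {x : EuclideanSpace ℝ (Fin (n + 1))}
    (hx : x (Fin.last n) = 0) : partialD (Fin.last n) f x = 0 := by
  have h := he.partialD_last_reflectLast hf x
  have hr : reflectLast x = x := by
    ext i
    by_cases hi : i = Fin.last n
    · subst hi; simp [reflectLast_apply_last, hx]
    · simp [reflectLast_apply_of_ne _ hi]
  rw [hr] at h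
  linarith

/-- By evenness the last derivative vanishes on the hyperplane, so at `x` it is the integral of the
second derivative along the vertical segment from the hyperplane to `x`. Dividing by `xₙ₊₁` leaves
an expression without singularity, from which the smoothness of `singularTerm` is read off. -/
theorem singularTerm_eq_integral {f : EuclideanSpace ℝ (Fin (n + 1)) → ℝ}
    (hf : ContDiff ℝ (2 : ℕ) f) (he : EvenInLast f) (x : EuclideanSpace ℝ (Fin (n + 1))) :
    singularTerm f x = ∫ t in (0 : ℝ)..1, partialD (Fin.last n) (partialD (Fin.last n) f)
      (x + ((t - 1) * x (Fin.last n)) • EuclideanSpace.single (Fin.last n) (1 : ℝ)) := by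
  have hfd : Differentiable ℝ f := hf.differentiable (by simp)
  have hc := contDiff_partialD (m := 1) (Fin.last n) hf
  have hd : Differentiable ℝ (partialD (Fin.last n) f) := hc.differentiable (by simp)
  have hc2 := (contDiff_partialD (m := 0) (Fin.last n) hc).continuous
  unfold singularTerm
  rw [partialLast_eq_partialD hfd, partialLast_eq_partialD hd]
  split_ifs with hx
  · simp [hx]
  · have hD : ∀ t : ℝ, HasDerivAt (fun t : ℝ => partialD (Fin.last n) f
        (x + ((t - 1) * x (Fin.last n)) • EuclideanSpace.single (Fin.last n) (1 : ℝ)))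
        (x (Fin.last n) * partialD (Fin.last n) (partialD (Fin.last n) f)
        (x + ((t - 1) * x (Fin.last n)) • EuclideanSpace.single (Fin.last n) (1 : ℝ))) t := by
      intro t
      have h1 : HasDerivAt (fun t : ℝ =>
          x + ((t - 1) * x (Fin.last n)) • EuclideanSpace.single (Fin.last n) (1 : ℝ))
          (x (Fin.last n) • EuclideanSpace.single (Fin.last n) (1 : ℝ)) t := by
        simpa using ((((hasDerivAt_id t).sub_const 1).mul_const (x (Fin.last n))).smul_const
          (EuclideanSpace.single (Fin.last n) (1 : ℝ))).const_add x
      have h2 := (hd (x + ((t - 1) * x (Fin.last n)) •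
        EuclideanSpace.single (Fin.last n) (1 : ℝ))).hasFDerivAt.comp_hasDerivAt t h1
      rw [map_smul, smul_eq_mul] at h2
      exact h2
    have h0 := intervalIntegral.integral_eq_sub_of_hasDerivAt (a := 0) (b := 1) (fun t _ => hD t)
      ((by fun_prop : Continuous _).intervalIntegrable _ _)
    rw [intervalIntegral.integral_const_mul] at h0
    have hz : partialD (Fin.last n) f (x + (((0 : ℝ) - 1) * x (Fin.last n)) •
        EuclideanSpace.single (Fin.last n) (1 : ℝ)) = 0 :=
      he.partialD_last_eq_zero hfd (by simp)
    rw [hz] at h0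
    rw [div_eq_iff hx, mul_comm, h0]
    simp

theorem contDiff_singularTerm {f : EuclideanSpace ℝ (Fin (n + 1)) → ℝ} {m : ℕ}
    (hf : ContDiff ℝ (m + 2 : ℕ) f) (he : EvenInLast f) : ContDiff ℝ m (singularTerm f) := by
  have h2 : ContDiff ℝ (2 : ℕ) f := hf.of_le (by exact_mod_cast Nat.le_add_left 2 m)
  rw [funext (singularTerm_eq_integral h2 he)]
  have hc := contDiff_partialD (Fin.last n) (contDiff_partialD (m := m + 1) (Fin.last n) hf)
  simpa using contDiff_intervalIntegral_param zero_le_one (k := fun _ => 1) continuous_const m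
    (F := fun (x : EuclideanSpace ℝ (Fin (n + 1))) (t : ℝ) =>
      partialD (Fin.last n) (partialD (Fin.last n) f)
      (x + ((t - 1) * x (Fin.last n)) • EuclideanSpace.single (Fin.last n) (1 : ℝ)))
    (hc.comp (by fun_prop))

theorem contDiff_negWeightedLaplacian (a : ℝ) {f : EuclideanSpace ℝ (Fin (n + 1)) → ℝ} {m : ℕ}
    (hf : ContDiff ℝ (m + 2 : ℕ) f) (he : EvenInLast f) :
    ContDiff ℝ m (negWeightedLaplacian a f) := by
  have h2 : ContDiff ℝ (2 : ℕ) f := hf.of_le (by exact_mod_cast Nat.le_add_left 2 m)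
  have h : negWeightedLaplacian a f = fun x =>
      -(∑ i, partialD i (partialD i f) x + (2 * a - 1) * singularTerm f x) :=
    funext fun x => by rw [negWeightedLaplacian, laplacian_eq_sum_partialD h2]
  rw [h]
  have hs := contDiff_singularTerm hf he
  have hc := fun i => contDiff_partialD i (contDiff_partialD (m := m + 1) i hf)
  exact ((ContDiff.sum fun i _ => hc i).add (contDiff_const.mul hs)).neg

theorem EvenInLast.negWeightedLaplacian (a : ℝ) {f : EuclideanSpace ℝ (Fin (n + 1)) → ℝ}
    (hf : ContDiff ℝ (2 : ℕ) f) (he : EvenInLast f) :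
    EvenInLast (negWeightedLaplacian a f) := fun x => by
  have hfd : Differentiable ℝ f := hf.differentiable (by simp)
  have hd : ∀ i, Differentiable ℝ (partialD i f) := fun i =>
    (contDiff_partialD (m := 1) _ hf).differentiable (by simp)
  have hll := he.partialD_last_partialD_last hf x
  have hs : singularTerm f (reflectLast x) = singularTerm f x := by
    unfold singularTerm
    rw [partialLast_eq_partialD hfd, partialLast_eq_partialD (hd _), hll,
      he.partialD_last_reflectLast hfd, reflectLast_apply_last]
    simp [neg_div_neg_eq]
  unfold WeightedLaplacian.negWeightedLaplacian
  rw [hs, laplacian_eq_sum_partialD hf, laplacian_eq_sum_partialD hf]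
  congr 2
  refine Finset.sum_congr rfl fun i _ => ?_
  by_cases hi : i = Fin.last n
  · subst hi; exact hll
  · exact (he.partialD_of_ne hfd hi).partialD_of_ne (hd i) hi x

/-- Each application costs two derivatives. Evenness is carried along because the singular term of
the next application is regular only for even functions. -/
theorem contDiff_iterate_negWeightedLaplacian (a : ℝ) (i : ℕ) {m : ℕ}
    {f : EuclideanSpace ℝ (Fin (n + 1)) → ℝ} (hf : ContDiff ℝ (m + 2 * i : ℕ) f)
    (he : EvenInLast f) :
    ContDiff ℝ m ((WeightedLaplacian.negWeightedLaplacian a)^[i] f) ∧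
      EvenInLast ((WeightedLaplacian.negWeightedLaplacian a)^[i] f) := by
  induction i generalizing m with
  | zero => exact ⟨by simpa using hf, he⟩
  | succ i ih =>
    obtain ⟨h1, h2⟩ := ih (m := m + 2) (by rw [show m + 2 + 2 * i = m + 2 * (i + 1) by ring]; exact hf)
    rw [Function.iterate_succ_apply']
    exact ⟨contDiff_negWeightedLaplacian a h1 h2, h2.negWeightedLaplacian a
      (h1.of_le (by exact_mod_cast Nat.le_add_left 2 m))⟩

/-! ### The weight and Green's identities -/

/-- The density `|xₙ₊₁|^(2a-1)` of the measure for which the operator is symmetric. -/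
noncomputable def weight (a : ℝ) (x : EuclideanSpace ℝ (Fin (n + 1))) : ℝ :=
  |x (Fin.last n)| ^ (2 * a - 1)

theorem weight_nonneg (a : ℝ) (x : EuclideanSpace ℝ (Fin (n + 1))) : 0 ≤ weight a x :=
  Real.rpow_nonneg (abs_nonneg _) _

theorem continuous_weight {a : ℝ} (ha : 1 ≤ a) :
    Continuous (weight a : EuclideanSpace ℝ (Fin (n + 1)) → ℝ) := by
  unfold weight
  exact (by fun_prop : Continuous fun x : EuclideanSpace ℝ (Fin (n + 1)) =>
    |x (Fin.last n)|).rpow_const fun _ => Or.inr (by linarith)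

theorem weight_eq_zero {a : ℝ} (ha : 1 ≤ a) {x : EuclideanSpace ℝ (Fin (n + 1))}
    (hx : x (Fin.last n) = 0) : weight a x = 0 := by
  rw [weight, hx, abs_zero, Real.zero_rpow (by linarith)]

theorem EvenInLast.partialD_last_eq_mul_singularTerm {f : EuclideanSpace ℝ (Fin (n + 1)) → ℝ}
    (hf : Differentiable ℝ f) (he : EvenInLast f) (x : EuclideanSpace ℝ (Fin (n + 1))) :
    partialD (Fin.last n) f x = x (Fin.last n) * singularTerm f x := by
  by_cases hx : x (Fin.last n) = 0
  · rw [he.partialD_last_eq_zero hf hx, hx, zero_mul]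
  · rw [singularTerm, if_neg hx, partialLast_eq_partialD hf]
    field_simp

/-- The difference quotient at `0` is `h` itself. This differentiates products at a point where one
factor is merely continuous: on the hyperplane, and at the kink of a truncated power. -/
theorem hasDerivAt_id_mul_of_continuousAt {h : ℝ → ℝ} (hh : ContinuousAt h 0) :
    HasDerivAt (fun t => t * h t) (h 0) 0 := by
  rw [hasDerivAt_iff_tendsto_slope_zero]
  refine (hh.tendsto.mono_left nhdsWithin_le_nhds).congr' ?_
  filter_upwards [self_mem_nhdsWithin] with t ht
  have ht' : t ≠ 0 := ht
  simp [ht']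

/-- This is the divergence form of the operator in the last variable. Evenness makes it hold on the
hyperplane as well, where the weight itself need not be differentiable. -/
theorem hasLineDerivAt_weight_mul_partialD_last {a : ℝ} (ha : 1 ≤ a)
    {f : EuclideanSpace ℝ (Fin (n + 1)) → ℝ} (hf : ContDiff ℝ (2 : ℕ) f) (he : EvenInLast f)
    (x : EuclideanSpace ℝ (Fin (n + 1))) :
    HasLineDerivAt ℝ (fun y => weight a y * partialD (Fin.last n) f y)
      (weight a x * (partialD (Fin.last n) (partialD (Fin.last n) f) x +
        (2 * a - 1) * singularTerm f x)) x (EuclideanSpace.single (Fin.last n) 1) := by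
  have hfd : Differentiable ℝ f := hf.differentiable (by simp)
  have hd : Differentiable ℝ (partialD (Fin.last n) f) :=
    (contDiff_partialD (m := 1) _ hf).differentiable (by simp)
  have hσ : Continuous (singularTerm f) := (contDiff_singularTerm (m := 0) hf he).continuous
  unfold HasLineDerivAt
  by_cases hx : x (Fin.last n) = 0
  · rw [weight_eq_zero ha hx, zero_mul]
    -- Through a point of the hyperplane, `∂f = t σ` with `σ` the singular term, so the product is
    -- `t` times a continuous function that vanishes at `t = 0`.
    have h := hasDerivAt_id_mul_of_continuousAt (h := fun t => |t| ^ (2 * a - 1) *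
      singularTerm f (x + t • EuclideanSpace.single (Fin.last n) (1 : ℝ)))
      (Continuous.continuousAt ((continuous_abs.rpow_const fun _ => Or.inr (by linarith)).mul
        (hσ.comp (by fun_prop))))
    simp only [abs_zero, Real.zero_rpow (by linarith : 2 * a - 1 ≠ 0), zero_mul] at h
    refine h.congr_of_eventuallyEq (Eventually.of_forall fun t => ?_)
    simp only [he.partialD_last_eq_mul_singularTerm hfd, weight, PiLp.add_apply, PiLp.smul_apply,
      PiLp.single_apply, hx, if_true, smul_eq_mul, mul_one, zero_add]
    ring
  · have h1 : HasDerivAt (fun t : ℝ => |x (Fin.last n) + t|) (SignType.sign (x (Fin.last n)) : ℝ)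
        0 := by
      have := (hasDerivAt_abs (x := x (Fin.last n) + 0) (by simpa using hx)).comp_const_add
        (x (Fin.last n)) 0
      simpa using this
    have h2 := h1.rpow_const (p := 2 * a - 1) (Or.inl (by simpa using hx))
    have h3 : HasDerivAt (fun t : ℝ => partialD (Fin.last n) f
        (x + t • EuclideanSpace.single (Fin.last n) (1 : ℝ)))
        (partialD (Fin.last n) (partialD (Fin.last n) f) x) 0 :=
      (hd x).hasFDerivAt.hasLineDerivAt _
    have h4 := h2.mul h3
    refine (h4.congr_of_eventuallyEq (Eventually.of_forall fun t => ?_)).congr_deriv ?_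
    · simp [weight]
    · symm
      rw [add_zero, zero_smul, add_zero, Real.rpow_sub_one (abs_ne_zero.mpr hx),
        he.partialD_last_eq_mul_singularTerm hfd, weight]
      have hs : (SignType.sign (x (Fin.last n)) : ℝ) * |x (Fin.last n)| = x (Fin.last n) :=
        sign_mul_abs _
      have hs2 : (SignType.sign (x (Fin.last n)) : ℝ) * x (Fin.last n) = |x (Fin.last n)| :=
        sign_mul_self _
      have h0 : |x (Fin.last n)| ≠ 0 := abs_ne_zero.mpr hx
      field_simp
      linear_combination (-(2 * a - 1) * singularTerm f x) * hs2

theorem hasLineDerivAt_weight_mul_partialD_of_ne (a : ℝ)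
    {f : EuclideanSpace ℝ (Fin (n + 1)) → ℝ} (hf : ContDiff ℝ (2 : ℕ) f)
    {i : Fin (n + 1)} (hi : i ≠ Fin.last n) (x : EuclideanSpace ℝ (Fin (n + 1))) :
    HasLineDerivAt ℝ (fun y => weight a y * partialD i f y)
      (weight a x * partialD i (partialD i f) x) x (EuclideanSpace.single i 1) := by
  have hd : Differentiable ℝ (partialD i f) :=
    (contDiff_partialD (m := 1) _ hf).differentiable (by simp)
  have h3 : HasDerivAt (fun t : ℝ => partialD i f (x + t • EuclideanSpace.single i (1 : ℝ)))
      (partialD i (partialD i f) x) 0 := (hd x).hasFDerivAt.hasLineDerivAt _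
  unfold HasLineDerivAt
  refine (h3.const_mul (weight a x)).congr_of_eventuallyEq (Eventually.of_forall fun t => ?_)
  simp [weight, Ne.symm hi]

theorem _root_.HasCompactSupport.partialD {f : EuclideanSpace ℝ (Fin (n + 1)) → ℝ}
    (hf : HasCompactSupport f) (i : Fin (n + 1)) : HasCompactSupport (partialD i f) :=
  hf.fderiv_apply (𝕜 := ℝ) _

theorem _root_.HasCompactSupport.singularTerm {f : EuclideanSpace ℝ (Fin (n + 1)) → ℝ}
    (hf : Differentiable ℝ f) (hd : Differentiable ℝ (WeightedLaplacian.partialD (Fin.last n) f))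
    (hc : HasCompactSupport f) : HasCompactSupport (singularTerm f) := by
  have h1 := hc.partialD (Fin.last n)
  have h2 := h1.partialD (Fin.last n)
  refine HasCompactSupport.intro (h1.isCompact.union h2.isCompact) fun x hx => ?_
  rw [mem_union, not_or] at hx
  rw [WeightedLaplacian.singularTerm, partialLast_eq_partialD hf, partialLast_eq_partialD hd,
    image_eq_zero_of_notMem_tsupport hx.1, image_eq_zero_of_notMem_tsupport hx.2]
  simp

/-- Green's first identity for the weighted Laplacian. -/
theorem integral_negWeightedLaplacian_mul {a : ℝ} (ha : 1 ≤ a)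
    {f φ : EuclideanSpace ℝ (Fin (n + 1)) → ℝ} (hf : ContDiff ℝ (2 : ℕ) f) (he : EvenInLast f)
    (hφ : ContDiff ℝ (1 : ℕ) φ) (hc : HasCompactSupport f ∨ HasCompactSupport φ) :
    ∫ x, negWeightedLaplacian a f x * φ x * weight a x =
      ∑ i, ∫ x, partialD i f x * partialD i φ x * weight a x := by
  have hfd : Differentiable ℝ f := hf.differentiable (by simp)
  have hφd : Differentiable ℝ φ := hφ.differentiable (by simp)
  have hc1 := fun i => contDiff_partialD (m := 1) i hf
  have hd : ∀ i, Differentiable ℝ (partialD i f) := fun i => (hc1 i).differentiable (by simp)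
  have hw : Continuous (weight a : EuclideanSpace ℝ (Fin (n + 1)) → ℝ) := continuous_weight ha
  have hσ : Continuous (singularTerm f) := (contDiff_singularTerm (m := 0) hf he).continuous
  have hcf := fun i => (hc1 i).continuous
  have hcff := fun i => (contDiff_partialD (m := 0) i (hc1 i)).continuous
  have hcφ := fun i => (contDiff_partialD (m := 0) i hφ).continuous
  have hφc := hφ.continuous
  -- The singular term is assigned to the last coordinate, so that `∑ i, G i = -negWeightedLaplacian
  -- a f` and each `weight a * G i` is a pure `i`-th derivative.
  let G : Fin (n + 1) → EuclideanSpace ℝ (Fin (n + 1)) → ℝ := fun i x =>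
    partialD i (partialD i f) x + if i = Fin.last n then (2 * a - 1) * singularTerm f x else 0
  have hG : ∀ i, Continuous (G i) := fun i => by
    by_cases hi : i = Fin.last n
    · simp only [G, hi, if_true]
      exact (hcff _).add (continuous_const.mul hσ)
    · simp only [G, hi, if_false, add_zero]
      exact hcff _
  have hint : ∀ A B : EuclideanSpace ℝ (Fin (n + 1)) → ℝ, Continuous A → Continuous B →
      (HasCompactSupport A ∨ HasCompactSupport B) →
      Integrable fun x => weight a x * A x * B x := by
    intro A B hA hB hAB
    refine Continuous.integrable_of_hasCompactSupport ((hw.mul hA).mul hB) ?_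
    rcases hAB with h | h
    · exact (h.mul_left (f := weight a)).mul_right
    · exact h.mul_left
  have hGc : ∀ i, HasCompactSupport (G i) ∨ HasCompactSupport φ := fun i => by
    refine hc.imp_left fun h => ?_
    refine HasCompactSupport.add ((h.partialD i).partialD i) ?_
    by_cases hi : i = Fin.last n
    · simp only [hi, if_true]
      exact (h.singularTerm hfd (hd _)).mul_left
    · simp only [hi, if_false]
      exact HasCompactSupport.zero
  have hline : ∀ i x, HasLineDerivAt ℝ (fun y => weight a y * partialD i f y)
      (weight a x * G i x) x (EuclideanSpace.single i 1) := fun i x => by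
    by_cases hi : i = Fin.last n
    · subst hi
      simpa [G] using hasLineDerivAt_weight_mul_partialD_last ha hf he x
    · simpa [G, hi] using hasLineDerivAt_weight_mul_partialD_of_ne a hf hi x
  have hkey : ∀ i, ∫ x, partialD i f x * partialD i φ x * weight a x =
      -∫ x, weight a x * G i x * φ x := fun i => by
    have := integral_bilinear_hasLineDerivAt_right_eq_neg_left_of_integrable (μ := volume)
      (B := ContinuousLinearMap.mul ℝ ℝ) (f := fun y => weight a y * partialD i f y)
      (f' := fun y => weight a y * G i y) (g := φ) (g' := partialD i φ)
      (v := EuclideanSpace.single i 1) (hint _ _ (hG i) hφc (hGc i))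
      (hint _ _ (hcf i) (hcφ i) (hc.imp (fun h => h.partialD i) fun h => h.partialD i))
      (hint _ _ (hcf i) hφc (hc.imp_left fun h => h.partialD i))
      (fun x _ => hline i x) (fun x _ => (hφd x).hasFDerivAt.hasLineDerivAt _)
    simp only [ContinuousLinearMap.mul_apply'] at this
    rw [← this]
    congr 1
    ext x
    ring
  simp only [hkey]
  rw [Finset.sum_neg_distrib, ← integral_finsetSum _ fun i _ => hint _ _ (hG i) hφc (hGc i),
    ← integral_neg]
  congr 1
  ext x
  rw [negWeightedLaplacian, laplacian_eq_sum_partialD hf, ← Finset.sum_mul, ← Finset.mul_sum]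
  simp only [G, Finset.sum_add_distrib, Finset.sum_ite_eq', Finset.mem_univ, if_true]
  ring

/-- Green's second identity for the weighted Laplacian. -/
theorem integral_negWeightedLaplacian_mul_comm {a : ℝ} (ha : 1 ≤ a)
    {f φ : EuclideanSpace ℝ (Fin (n + 1)) → ℝ} (hf : ContDiff ℝ (2 : ℕ) f) (hfe : EvenInLast f)
    (hφ : ContDiff ℝ (2 : ℕ) φ) (hφe : EvenInLast φ) (hc : HasCompactSupport φ) :
    ∫ x, negWeightedLaplacian a f x * φ x * weight a x =
      ∫ x, f x * negWeightedLaplacian a φ x * weight a x := by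
  rw [integral_negWeightedLaplacian_mul ha hf hfe (hφ.of_le (by norm_num)) (Or.inr hc)]
  have h := integral_negWeightedLaplacian_mul ha hφ hφe (hf.of_le (by norm_num)) (Or.inl hc)
  simp only [mul_comm (f _), mul_comm (partialD _ f _)]
  exact h.symm

/-! ### Bessel translation of radial functions -/

/-- The square of the distance which underlies the Bessel translation: with `s = xₙ₊₁` and
`y = (x₀)ₙ₊₁` it is `|x' - x₀'|² + s² + y² - 2 s y cos θ`. -/
noncomputable def besselSqDist (x₀ x : EuclideanSpace ℝ (Fin (n + 1))) (θ : ℝ) : ℝ :=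
  ‖x - x₀‖ ^ 2 + 2 * x (Fin.last n) * x₀ (Fin.last n) * (1 - Real.cos θ)

/-- The Bessel translation to `x₀` of the radial function `x ↦ h (|x|²)`. -/
noncomputable def besselMean (a : ℝ) (x₀ : EuclideanSpace ℝ (Fin (n + 1))) (h : ℝ → ℝ)
    (x : EuclideanSpace ℝ (Fin (n + 1))) : ℝ :=
  ∫ θ in (0 : ℝ)..Real.pi, Real.sin θ ^ (2 * a - 2) * h (besselSqDist x₀ x θ)

theorem continuous_sin_rpow {b : ℝ} (hb : 0 ≤ b) : Continuous fun θ : ℝ => Real.sin θ ^ b :=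
  Real.continuous_sin.rpow_const fun _ => Or.inr hb

theorem norm_sub_reflectLast_sq (x₀ x : EuclideanSpace ℝ (Fin (n + 1))) :
    ‖x - reflectLast x₀‖ ^ 2 = ‖x - x₀‖ ^ 2 + 4 * x (Fin.last n) * x₀ (Fin.last n) := by
  rw [EuclideanSpace.norm_sq_eq, EuclideanSpace.norm_sq_eq, Fin.sum_univ_castSucc,
    Fin.sum_univ_castSucc]
  have h : ∀ i : Fin n, reflectLast x₀ i.castSucc = x₀ i.castSucc := fun i =>
    reflectLast_apply_of_ne _ (Fin.castSucc_lt_last i).ne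
  simp only [PiLp.sub_apply, h, reflectLast_apply_last, Real.norm_eq_abs, sq_abs]
  ring

/-- A convex combination of the squared distances to `x₀` and to its reflection: this yields the
lower bounds that locate the supports of translated functions. -/
theorem besselSqDist_eq_combination (x₀ x : EuclideanSpace ℝ (Fin (n + 1))) (θ : ℝ) :
    besselSqDist x₀ x θ = (1 + Real.cos θ) / 2 * ‖x - x₀‖ ^ 2 +
      (1 - Real.cos θ) / 2 * ‖x - reflectLast x₀‖ ^ 2 := by
  rw [norm_sub_reflectLast_sq, besselSqDist]
  ring

theorem min_le_besselSqDist (x₀ x : EuclideanSpace ℝ (Fin (n + 1))) (θ : ℝ) :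
    min (‖x - x₀‖ ^ 2) (‖x - reflectLast x₀‖ ^ 2) ≤ besselSqDist x₀ x θ := by
  rw [besselSqDist_eq_combination]
  have h1 := Real.neg_one_le_cos θ
  have h2 := Real.cos_le_one θ
  have h3 := min_le_left (‖x - x₀‖ ^ 2) (‖x - reflectLast x₀‖ ^ 2)
  have h4 := min_le_right (‖x - x₀‖ ^ 2) (‖x - reflectLast x₀‖ ^ 2)
  nlinarith

theorem besselSqDist_nonneg (x₀ x : EuclideanSpace ℝ (Fin (n + 1))) (θ : ℝ) :
    0 ≤ besselSqDist x₀ x θ :=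
  (le_min (by positivity) (by positivity)).trans (min_le_besselSqDist x₀ x θ)

theorem sq_norm_sub_norm_le_besselSqDist (x₀ x : EuclideanSpace ℝ (Fin (n + 1))) (θ : ℝ) :
    (‖x‖ - ‖x₀‖) ^ 2 ≤ besselSqDist x₀ x θ := by
  refine le_trans (le_min ?_ ?_) (min_le_besselSqDist x₀ x θ)
  · exact sq_le_sq' (by linarith [abs_le.1 (abs_norm_sub_norm_le x x₀)])
      ((le_abs_self _).trans (abs_norm_sub_norm_le x x₀))
  · rw [← norm_reflectLast x₀]
    exact sq_le_sq' (by linarith [abs_le.1 (abs_norm_sub_norm_le x (reflectLast x₀))])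
      ((le_abs_self _).trans (abs_norm_sub_norm_le x (reflectLast x₀)))

/-- Reflecting `x` exchanges the two squared distances, and `θ ↦ π - θ` exchanges their
coefficients. As the sine is unchanged, `besselMean` is even. -/
theorem besselSqDist_reflectLast (x₀ x : EuclideanSpace ℝ (Fin (n + 1))) (θ : ℝ) :
    besselSqDist x₀ (reflectLast x) (Real.pi - θ) = besselSqDist x₀ x θ := by
  have h : ‖reflectLast x - x₀‖ = ‖x - reflectLast x₀‖ := by
    rw [← norm_reflectLast (x - reflectLast x₀), ← reflectLastCLM_apply (x - _), map_sub,
      reflectLastCLM_apply, reflectLastCLM_apply, reflectLast_reflectLast]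
  rw [besselSqDist, besselSqDist, h, norm_sub_reflectLast_sq, reflectLast_apply_last,
    Real.cos_pi_sub]
  ring

theorem contDiff_besselSqDist (x₀ : EuclideanSpace ℝ (Fin (n + 1))) {m : ℕ} :
    ContDiff ℝ m fun z : EuclideanSpace ℝ (Fin (n + 1)) × ℝ => besselSqDist x₀ z.1 z.2 := by
  unfold besselSqDist
  exact ((contDiff_fst.sub contDiff_const).norm_sq ℝ).add (by fun_prop)

theorem continuous_besselSqDist (x₀ : EuclideanSpace ℝ (Fin (n + 1))) :
    Continuous fun z : EuclideanSpace ℝ (Fin (n + 1)) × ℝ => besselSqDist x₀ z.1 z.2 :=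
  (contDiff_besselSqDist x₀ (m := 0)).continuous

theorem continuous_besselSqDist_right (x₀ x : EuclideanSpace ℝ (Fin (n + 1))) :
    Continuous (besselSqDist x₀ x) := by
  unfold besselSqDist
  fun_prop

/-- The derivative of `besselSqDist x₀ x θ` in the direction of the `i`-th coordinate of `x`. -/
noncomputable def besselSqDistDeriv (x₀ : EuclideanSpace ℝ (Fin (n + 1))) (i : Fin (n + 1))
    (x : EuclideanSpace ℝ (Fin (n + 1))) (θ : ℝ) : ℝ :=
  2 * (x i - x₀ i) + if i = Fin.last n then 2 * x₀ (Fin.last n) * (1 - Real.cos θ) else 0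

theorem continuous_besselSqDistDeriv (x₀ : EuclideanSpace ℝ (Fin (n + 1))) (i : Fin (n + 1)) :
    Continuous fun z : EuclideanSpace ℝ (Fin (n + 1)) × ℝ => besselSqDistDeriv x₀ i z.1 z.2 := by
  unfold besselSqDistDeriv
  by_cases hi : i = Fin.last n <;> simp only [hi, if_true, if_false] <;> fun_prop

theorem continuous_besselSqDistDeriv_right (x₀ : EuclideanSpace ℝ (Fin (n + 1)))
    (i : Fin (n + 1)) (x : EuclideanSpace ℝ (Fin (n + 1))) :
    Continuous (besselSqDistDeriv x₀ i x) := by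
  unfold besselSqDistDeriv
  by_cases hi : i = Fin.last n <;> simp only [hi, if_true, if_false] <;> fun_prop

theorem besselSqDist_add_smul_single (x₀ x : EuclideanSpace ℝ (Fin (n + 1))) (i : Fin (n + 1))
    (t θ : ℝ) :
    besselSqDist x₀ (x + t • EuclideanSpace.single i 1) θ =
      besselSqDist x₀ x θ + besselSqDistDeriv x₀ i x θ * t + t ^ 2 := by
  have h : ‖x + t • EuclideanSpace.single i (1 : ℝ) - x₀‖ ^ 2 =
      ‖x - x₀‖ ^ 2 + 2 * (x i - x₀ i) * t + t ^ 2 := by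
    rw [show x + t • EuclideanSpace.single i (1 : ℝ) - x₀ =
      (x - x₀) + t • EuclideanSpace.single i (1 : ℝ) by abel, norm_add_sq_real, inner_smul_right,
      EuclideanSpace.inner_single_right, norm_smul, PiLp.norm_single]
    simp
    ring
  rw [besselSqDist, besselSqDist, besselSqDistDeriv, h]
  by_cases hi : i = Fin.last n
  · subst hi
    simp
    ring
  · simp [hi, Ne.symm hi]
    ring

theorem besselSqDistDeriv_add_smul_single (x₀ x : EuclideanSpace ℝ (Fin (n + 1)))
    (i : Fin (n + 1)) (t θ : ℝ) :
    besselSqDistDeriv x₀ i (x + t • EuclideanSpace.single i 1) θ =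
      besselSqDistDeriv x₀ i x θ + 2 * t := by
  simp [besselSqDistDeriv]
  ring

theorem hasDerivAt_besselSqDist_line (x₀ x : EuclideanSpace ℝ (Fin (n + 1))) (i : Fin (n + 1))
    (t θ : ℝ) :
    HasDerivAt (fun t : ℝ => besselSqDist x₀ (x + t • EuclideanSpace.single i 1) θ)
      (besselSqDistDeriv x₀ i (x + t • EuclideanSpace.single i 1) θ) t := by
  simp only [besselSqDist_add_smul_single, besselSqDistDeriv_add_smul_single]
  exact ((((hasDerivAt_id' t).const_mul (besselSqDistDeriv x₀ i x θ)).const_add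
    (besselSqDist x₀ x θ)).add (hasDerivAt_pow 2 t)).congr_deriv (by simp)

theorem hasDerivAt_besselSqDistDeriv_line (x₀ x : EuclideanSpace ℝ (Fin (n + 1)))
    (i : Fin (n + 1)) (t θ : ℝ) :
    HasDerivAt (fun t : ℝ => besselSqDistDeriv x₀ i (x + t • EuclideanSpace.single i 1) θ) 2 t := by
  simp only [besselSqDistDeriv_add_smul_single]
  simpa using ((hasDerivAt_id t).const_mul 2).const_add (besselSqDistDeriv x₀ i x θ)

theorem hasDerivAt_besselSqDist_angle (x₀ x : EuclideanSpace ℝ (Fin (n + 1))) (θ : ℝ) :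
    HasDerivAt (besselSqDist x₀ x)
      (2 * x (Fin.last n) * x₀ (Fin.last n) * Real.sin θ) θ := by
  unfold besselSqDist
  simpa using (((Real.hasDerivAt_cos θ).const_sub 1).const_mul
    (2 * x (Fin.last n) * x₀ (Fin.last n))).const_add (‖x - x₀‖ ^ 2)

/-- With `s = xₙ₊₁` and `y = (x₀)ₙ₊₁`, the squared distance is `|x' - x₀'|² + (s - y cos θ)² + (y
sin θ)²`, and the `x`-gradient sees only the first two terms. The defect `(y sin θ)²` is later
cancelled by an angular derivative. -/
theorem sum_besselSqDistDeriv_sq (x₀ x : EuclideanSpace ℝ (Fin (n + 1))) (θ : ℝ) :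
    ∑ i, besselSqDistDeriv x₀ i x θ ^ 2 =
      4 * (besselSqDist x₀ x θ - (x₀ (Fin.last n) * Real.sin θ) ^ 2) := by
  have h : ∀ i : Fin n, i.castSucc ≠ Fin.last n := fun i => (Fin.castSucc_lt_last i).ne
  rw [besselSqDist, EuclideanSpace.norm_sq_eq, Fin.sum_univ_castSucc, Fin.sum_univ_castSucc]
  simp only [besselSqDistDeriv, h, if_true, if_false, PiLp.sub_apply, Real.norm_eq_abs, sq_abs,
    add_zero, mul_pow, Real.sin_sq, ← Finset.mul_sum]
  ring

theorem contDiff_besselMean {a : ℝ} (ha : 1 ≤ a) (x₀ : EuclideanSpace ℝ (Fin (n + 1)))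
    {h : ℝ → ℝ} {m : ℕ} (hh : ContDiff ℝ m h) : ContDiff ℝ m (besselMean a x₀ h) :=
  contDiff_intervalIntegral_param Real.pi_pos.le (continuous_sin_rpow (b := 2 * a - 2)
    (by linarith)) m (F := fun x θ => h (besselSqDist x₀ x θ)) (hh.comp (contDiff_besselSqDist x₀))

theorem evenInLast_besselMean (a : ℝ) (x₀ : EuclideanSpace ℝ (Fin (n + 1))) (h : ℝ → ℝ) :
    EvenInLast (besselMean a x₀ h) := fun x => by
  have h1 := intervalIntegral.integral_comp_sub_left (a := 0) (b := Real.pi)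
    (fun θ => Real.sin θ ^ (2 * a - 2) * h (besselSqDist x₀ (reflectLast x) θ)) Real.pi
  simp only [sub_self, sub_zero, besselSqDist_reflectLast, Real.sin_pi_sub] at h1
  exact h1.symm

theorem besselMean_eq_zero (a : ℝ) {x₀ x : EuclideanSpace ℝ (Fin (n + 1))} {h : ℝ → ℝ} {R : ℝ}
    (hR : 0 ≤ R) (hh : ∀ t, R ^ 2 ≤ t → h t = 0) (hx : ‖x₀‖ + R ≤ ‖x‖) :
    besselMean a x₀ h x = 0 := by
  unfold besselMean
  refine (intervalIntegral.integral_congr fun θ _ => ?_).trans intervalIntegral.integral_zero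
  have h1 := sq_norm_sub_norm_le_besselSqDist x₀ x θ
  have h2 : R ^ 2 ≤ (‖x‖ - ‖x₀‖) ^ 2 := pow_le_pow_left₀ hR (by linarith) 2
  simp [hh _ (h2.trans h1)]

theorem hasCompactSupport_besselMean (a : ℝ) (x₀ : EuclideanSpace ℝ (Fin (n + 1))) {h : ℝ → ℝ}
    {R : ℝ} (hR : 0 ≤ R) (hh : ∀ t, R ^ 2 ≤ t → h t = 0) :
    HasCompactSupport (besselMean a x₀ h) :=
  HasCompactSupport.intro (isCompact_closedBall 0 (‖x₀‖ + R)) fun x hx =>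
    besselMean_eq_zero a hR hh (by simpa using (not_le.1 (by simpa using hx)).le)

/-- Differentiability is assumed, so only the derivative along one coordinate line has to be
identified. -/
theorem partialD_integral_param {k : ℝ → ℝ} (hk : Continuous k) (i : Fin (n + 1))
    {G G' : EuclideanSpace ℝ (Fin (n + 1)) → ℝ → ℝ}
    (hG : Continuous fun z : EuclideanSpace ℝ (Fin (n + 1)) × ℝ => G z.1 z.2)
    (hG' : Continuous fun z : EuclideanSpace ℝ (Fin (n + 1)) × ℝ => G' z.1 z.2)
    (hd : ∀ x θ t, HasDerivAt (fun t : ℝ => G (x + t • EuclideanSpace.single i 1) θ)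
      (G' (x + t • EuclideanSpace.single i 1) θ) t)
    (hD : Differentiable ℝ fun x => ∫ θ in (0 : ℝ)..Real.pi, k θ * G x θ) :
    partialD i (fun x => ∫ θ in (0 : ℝ)..Real.pi, k θ * G x θ) =
      fun x => ∫ θ in (0 : ℝ)..Real.pi, k θ * G' x θ := by
  ext x
  have h1 := (hD x).hasFDerivAt.hasLineDerivAt (EuclideanSpace.single i 1)
  have h2 := hasDerivAt_intervalIntegral_param Real.pi_pos.le
    (F := fun t θ => k θ * G (x + t • EuclideanSpace.single i 1) θ)
    (F' := fun t θ => k θ * G' (x + t • EuclideanSpace.single i 1) θ)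
    (fun t => hk.mul (hG.comp (by fun_prop : Continuous fun θ : ℝ =>
      (x + t • EuclideanSpace.single i (1 : ℝ), θ))))
    ((hk.comp continuous_snd).mul (hG'.comp (by fun_prop : Continuous fun z : ℝ × ℝ =>
      (x + z.1 • EuclideanSpace.single i (1 : ℝ), z.2))))
    (fun t θ => (hd x θ t).const_mul _) 0
  rw [zero_smul, add_zero] at h2
  exact HasDerivAt.unique h1 h2

theorem contDiff_two_of_hasDerivAt {h h₁ h₂ : ℝ → ℝ} (hh : ∀ t, HasDerivAt h (h₁ t) t)
    (hh₁ : ∀ t, HasDerivAt h₁ (h₂ t) t) (hh₂ : Continuous h₂) : ContDiff ℝ (2 : ℕ) h := by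
  have e1 : deriv h = h₁ := funext fun t => (hh t).deriv
  have e2 : deriv h₁ = h₂ := funext fun t => (hh₁ t).deriv
  have c1 : ContDiff ℝ 1 h₁ := by
    rw [contDiff_one_iff_deriv, e2]
    exact ⟨fun t => (hh₁ t).differentiableAt, hh₂⟩
  rw [show ((2 : ℕ) : WithTop ℕ∞) = 1 + 1 by norm_num, contDiff_succ_iff_deriv, e1]
  exact ⟨fun t => (hh t).differentiableAt, by simp, c1⟩

theorem partialD_besselMean {a : ℝ} (ha : 1 ≤ a) (x₀ : EuclideanSpace ℝ (Fin (n + 1)))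
    {h h₁ : ℝ → ℝ} (hh : ∀ t, HasDerivAt h (h₁ t) t) (hh₁ : Continuous h₁)
    (hΦ : Differentiable ℝ (besselMean a x₀ h)) (i : Fin (n + 1)) :
    partialD i (besselMean a x₀ h) = fun x => ∫ θ in (0 : ℝ)..Real.pi,
      Real.sin θ ^ (2 * a - 2) * (h₁ (besselSqDist x₀ x θ) * besselSqDistDeriv x₀ i x θ) := by
  have hk : Continuous fun θ : ℝ => Real.sin θ ^ (2 * a - 2) := continuous_sin_rpow (by linarith)
  have hcont : Continuous h := continuous_iff_continuousAt.2 fun t => (hh t).continuousAt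
  have hq := continuous_besselSqDist x₀
  exact partialD_integral_param hk i (hcont.comp hq)
    ((hh₁.comp hq).mul (continuous_besselSqDistDeriv x₀ i))
    (fun x θ t => (hh _).comp t (hasDerivAt_besselSqDist_line x₀ x i t θ)) hΦ

theorem partialD_partialD_besselMean {a : ℝ} (ha : 1 ≤ a) (x₀ : EuclideanSpace ℝ (Fin (n + 1)))
    {h h₁ h₂ : ℝ → ℝ} (hh : ∀ t, HasDerivAt h (h₁ t) t)
    (hh₁ : ∀ t, HasDerivAt h₁ (h₂ t) t) (hh₂ : Continuous h₂) (i : Fin (n + 1)) :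
    partialD i (partialD i (besselMean a x₀ h)) = fun x => ∫ θ in (0 : ℝ)..Real.pi,
      Real.sin θ ^ (2 * a - 2) * (h₂ (besselSqDist x₀ x θ) * besselSqDistDeriv x₀ i x θ *
        besselSqDistDeriv x₀ i x θ + h₁ (besselSqDist x₀ x θ) * 2) := by
  have hk : Continuous fun θ : ℝ => Real.sin θ ^ (2 * a - 2) := continuous_sin_rpow (by linarith)
  have hcont₁ : Continuous h₁ := continuous_iff_continuousAt.2 fun t => (hh₁ t).continuousAt
  have hq := continuous_besselSqDist x₀
  have hq' := continuous_besselSqDistDeriv x₀ i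
  have hΦ : ContDiff ℝ (2 : ℕ) (besselMean a x₀ h) :=
    contDiff_besselMean ha x₀ (contDiff_two_of_hasDerivAt hh hh₁ hh₂)
  have hd : Differentiable ℝ (partialD i (besselMean a x₀ h)) :=
    (contDiff_partialD (m := 1) i hΦ).differentiable (by simp)
  rw [partialD_besselMean ha x₀ hh hcont₁ (hΦ.differentiable (by simp))] at hd ⊢
  exact partialD_integral_param hk i ((hcont₁.comp hq).mul hq')
    ((((hh₂.comp hq).mul hq').mul hq').add ((hcont₁.comp hq).mul continuous_const))
    (fun x θ t => ((hh₁ _).comp t (hasDerivAt_besselSqDist_line x₀ x i t θ)).mul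
      (hasDerivAt_besselSqDistDeriv_line x₀ x i t θ)) hd

/-- The angular total derivative by which the translation intertwines the Bessel operator. -/
theorem integral_besselMean_angle_deriv {a : ℝ} (ha : 1 ≤ a)
    (x₀ x : EuclideanSpace ℝ (Fin (n + 1))) {h₁ h₂ : ℝ → ℝ}
    (hh₁ : ∀ t, HasDerivAt h₁ (h₂ t) t) (hh₂ : Continuous h₂) :
    ∫ θ in (0 : ℝ)..Real.pi, Real.sin θ ^ (2 * a - 2) *
      (2 * x (Fin.last n) * x₀ (Fin.last n) * Real.sin θ ^ 2 * h₂ (besselSqDist x₀ x θ) +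
        (2 * a - 1) * Real.cos θ * h₁ (besselSqDist x₀ x θ)) = 0 := by
  have hcont₁ : Continuous h₁ := continuous_iff_continuousAt.2 fun t => (hh₁ t).continuousAt
  have hqx : Continuous (besselSqDist x₀ x) := continuous_besselSqDist_right x₀ x
  have hcq : Continuous fun θ => h₁ (besselSqDist x₀ x θ) := hcont₁.comp hqx
  have hcq₂ : Continuous fun θ => h₂ (besselSqDist x₀ x θ) := hh₂.comp hqx
  have hk := continuous_sin_rpow (b := 2 * a - 2) (by linarith)
  -- The primitive `h₁(q) sin^(2a-1) θ` vanishes at both endpoints. Its derivative is needed only in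
  -- the open interval, where `sin θ ≠ 0`.
  have hdθ : ∀ θ ∈ Ioo 0 Real.pi,
      HasDerivAt (fun θ => h₁ (besselSqDist x₀ x θ) * Real.sin θ ^ (2 * a - 1))
      (Real.sin θ ^ (2 * a - 2) *
      (2 * x (Fin.last n) * x₀ (Fin.last n) * Real.sin θ ^ 2 * h₂ (besselSqDist x₀ x θ) +
        (2 * a - 1) * Real.cos θ * h₁ (besselSqDist x₀ x θ))) θ := by
    intro θ hθ
    have hs : 0 < Real.sin θ := Real.sin_pos_of_mem_Ioo hθ
    have hA : HasDerivAt (fun θ => h₁ (besselSqDist x₀ x θ)) (h₂ (besselSqDist x₀ x θ) *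
        (2 * x (Fin.last n) * x₀ (Fin.last n) * Real.sin θ)) θ :=
      (hh₁ _).comp θ (hasDerivAt_besselSqDist_angle x₀ x θ)
    have hB : HasDerivAt (fun θ => Real.sin θ ^ (2 * a - 1))
        (Real.cos θ * (2 * a - 1) * Real.sin θ ^ (2 * a - 2)) θ := by
      have := (Real.hasDerivAt_sin θ).rpow_const (p := 2 * a - 1) (Or.inl hs.ne')
      rwa [show 2 * a - 1 - 1 = 2 * a - 2 by ring] at this
    have hr : Real.sin θ ^ (2 * a - 1) = Real.sin θ ^ (2 * a - 2) * Real.sin θ := by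
      rw [← Real.rpow_add_one hs.ne']
      ring_nf
    refine (hA.mul hB).congr_deriv ?_
    rw [hr]
    ring
  have hk1 : Continuous fun θ : ℝ => Real.sin θ ^ (2 * a - 1) := continuous_sin_rpow (by linarith)
  have hint : Continuous fun θ => Real.sin θ ^ (2 * a - 2) *
      (2 * x (Fin.last n) * x₀ (Fin.last n) * Real.sin θ ^ 2 * h₂ (besselSqDist x₀ x θ) +
        (2 * a - 1) * Real.cos θ * h₁ (besselSqDist x₀ x θ)) := by
    refine hk.mul (Continuous.add ?_ ?_) <;> fun_prop
  have hzero := intervalIntegral.integral_eq_sub_of_hasDerivAt_of_le Real.pi_pos.le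
    (hcq.mul hk1).continuousOn hdθ (hint.intervalIntegrable _ _)
  rw [hzero]
  simp [Real.zero_rpow (by linarith : 2 * a - 1 ≠ 0)]

/-- On translated radial functions the operator acts as the radial part of the Laplacian in
dimension `n + 2a`. -/
theorem negWeightedLaplacian_besselMean {a : ℝ} (ha : 1 ≤ a)
    (x₀ : EuclideanSpace ℝ (Fin (n + 1))) {h h₁ h₂ : ℝ → ℝ} (hh : ∀ t, HasDerivAt h (h₁ t) t)
    (hh₁ : ∀ t, HasDerivAt h₁ (h₂ t) t) (hh₂ : Continuous h₂)
    {x : EuclideanSpace ℝ (Fin (n + 1))} (hx : x (Fin.last n) ≠ 0) :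
    negWeightedLaplacian a (besselMean a x₀ h) x =
      besselMean a x₀ (fun t => -(4 * t * h₂ t + 2 * (n + 2 * a) * h₁ t)) x := by
  have hk : Continuous fun θ : ℝ => Real.sin θ ^ (2 * a - 2) := continuous_sin_rpow (by linarith)
  have hC : ContDiff ℝ (2 : ℕ) h := contDiff_two_of_hasDerivAt hh hh₁ hh₂
  have hcont₁ : Continuous h₁ := continuous_iff_continuousAt.2 fun t => (hh₁ t).continuousAt
  have hΦ : ContDiff ℝ (2 : ℕ) (besselMean a x₀ h) := contDiff_besselMean ha x₀ hC
  have hqx : Continuous (besselSqDist x₀ x) := continuous_besselSqDist_right x₀ x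
  have hqx' : ∀ i, Continuous (besselSqDistDeriv x₀ i x) := fun i =>
    continuous_besselSqDistDeriv_right x₀ i x
  have hcq : Continuous fun θ => h₁ (besselSqDist x₀ x θ) := hcont₁.comp hqx
  have hcq₂ : Continuous fun θ => h₂ (besselSqDist x₀ x θ) := hh₂.comp hqx
  have hI₁ : ∀ i, IntervalIntegrable (fun θ => Real.sin θ ^ (2 * a - 2) *
      (h₂ (besselSqDist x₀ x θ) * besselSqDistDeriv x₀ i x θ * besselSqDistDeriv x₀ i x θ +
        h₁ (besselSqDist x₀ x θ) * 2)) volume 0 Real.pi := fun i =>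
    (hk.mul (((hcq₂.mul (hqx' i)).mul (hqx' i)).add
      (hcq.mul continuous_const))).intervalIntegrable _ _
  have hI₀ : IntervalIntegrable (fun θ => ∑ i, Real.sin θ ^ (2 * a - 2) *
      (h₂ (besselSqDist x₀ x θ) * besselSqDistDeriv x₀ i x θ * besselSqDistDeriv x₀ i x θ +
        h₁ (besselSqDist x₀ x θ) * 2)) volume 0 Real.pi :=
    (continuous_finsetSum _ fun i _ => hk.mul (((hcq₂.mul (hqx' i)).mul (hqx' i)).add
      (hcq.mul continuous_const))).intervalIntegrable _ _
  have hI₂ : IntervalIntegrable (fun θ => Real.sin θ ^ (2 * a - 2) *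
      (h₁ (besselSqDist x₀ x θ) * besselSqDistDeriv x₀ (Fin.last n) x θ)) volume 0 Real.pi :=
    (hk.mul (hcq.mul (hqx' _))).intervalIntegrable _ _
  have hI₃ : IntervalIntegrable (fun θ => Real.sin θ ^ (2 * a - 2) *
      -(4 * besselSqDist x₀ x θ * h₂ (besselSqDist x₀ x θ) +
        2 * (n + 2 * a) * h₁ (besselSqDist x₀ x θ))) volume 0 Real.pi :=
    (hk.mul (((continuous_const.mul hqx).mul hcq₂).add
      (continuous_const.mul hcq)).neg).intervalIntegrable _ _
  have hsum : (∑ i, ∫ θ in (0 : ℝ)..Real.pi, Real.sin θ ^ (2 * a - 2) *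
      (h₂ (besselSqDist x₀ x θ) * besselSqDistDeriv x₀ i x θ * besselSqDistDeriv x₀ i x θ +
        h₁ (besselSqDist x₀ x θ) * 2)) + (2 * a - 1) / x (Fin.last n) *
      (∫ θ in (0 : ℝ)..Real.pi, Real.sin θ ^ (2 * a - 2) *
      (h₁ (besselSqDist x₀ x θ) * besselSqDistDeriv x₀ (Fin.last n) x θ)) +
      (∫ θ in (0 : ℝ)..Real.pi, Real.sin θ ^ (2 * a - 2) *
      -(4 * besselSqDist x₀ x θ * h₂ (besselSqDist x₀ x θ) +
        2 * (n + 2 * a) * h₁ (besselSqDist x₀ x θ))) = 0 := by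
    rw [← intervalIntegral.integral_finsetSum fun i _ => hI₁ i,
      ← intervalIntegral.integral_const_mul, ← intervalIntegral.integral_add
        hI₀ (hI₂.const_mul _), ← intervalIntegral.integral_add (hI₀.add (hI₂.const_mul _)) hI₃]
    -- Since `2(n+1) + 2(2a-1) = 2(n+2a)`, the integrands cancel up to `-(2y/s)` times the angular
    -- total derivative, with `s = xₙ₊₁` and `y = (x₀)ₙ₊₁`.
    refine Eq.trans ?_ ((congrArg (fun y => -(2 * x₀ (Fin.last n) / x (Fin.last n)) * y)
      (integral_besselMean_angle_deriv ha x₀ x hh₁ hh₂)).trans (mul_zero _))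
    beta_reduce
    rw [← intervalIntegral.integral_const_mul]
    refine intervalIntegral.integral_congr fun θ _ => ?_
    have hs := sum_besselSqDistDeriv_sq x₀ x θ
    have e : ∀ i, Real.sin θ ^ (2 * a - 2) *
      (h₂ (besselSqDist x₀ x θ) * besselSqDistDeriv x₀ i x θ * besselSqDistDeriv x₀ i x θ +
        h₁ (besselSqDist x₀ x θ) * 2) = Real.sin θ ^ (2 * a - 2) * h₂ (besselSqDist x₀ x θ) *
        besselSqDistDeriv x₀ i x θ ^ 2 + Real.sin θ ^ (2 * a - 2) * h₁ (besselSqDist x₀ x θ) * 2 :=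
      fun i => by ring
    simp only [e, Finset.sum_add_distrib, ← Finset.mul_sum, hs, Finset.sum_const, Finset.card_univ,
      Fintype.card_fin, nsmul_eq_mul]
    rw [besselSqDistDeriv, if_pos rfl]
    push_cast
    field_simp
    ring
  rw [negWeightedLaplacian, laplacian_eq_sum_partialD hΦ, singularTerm, if_neg hx,
    partialLast_eq_partialD (hΦ.differentiable (by simp)), besselMean,
    partialD_besselMean ha x₀ hh hcont₁ (hΦ.differentiable (by simp))]
  simp only [partialD_partialD_besselMean ha x₀ hh hh₁ hh₂]
  rw [mul_div_assoc', mul_div_right_comm]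
  linarith

/-! ### Truncated polynomial profiles and Young's inequality -/

open Polynomial

theorem hasDerivAt_posPart_pow (m : ℕ) (s : ℝ) :
    HasDerivAt (fun s : ℝ => max 0 s ^ (m + 2)) ((m + 2 : ℕ) * max 0 s ^ (m + 1)) s := by
  rcases lt_trichotomy s 0 with hs | rfl | hs
  · rw [max_eq_left hs.le, zero_pow (by omega), mul_zero]
    refine (hasDerivAt_const s (0 : ℝ)).congr_of_eventuallyEq ?_
    filter_upwards [Iio_mem_nhds hs] with t ht
    rw [max_eq_left (le_of_lt ht), zero_pow (by omega)]
  · have h := hasDerivAt_id_mul_of_continuousAt (h := fun t : ℝ => max 0 t ^ (m + 1))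
      (by fun_prop)
    simp only [max_self, ne_eq, Nat.add_eq_zero_iff, one_ne_zero, and_false, not_false_eq_true,
      zero_pow, mul_zero] at h ⊢
    refine h.congr_of_eventuallyEq (Eventually.of_forall fun t => ?_)
    rcases le_total t 0 with ht | ht
    · simp [max_eq_left ht]
    · simp only [max_eq_right ht]
      ring
  · rw [max_eq_right hs.le]
    refine (hasDerivAt_pow (m + 2) s).congr_of_eventuallyEq ?_
    filter_upwards [Ioi_mem_nhds hs] with t ht
    rw [max_eq_right (le_of_lt ht)]

/-- The profile `P(t) (1 - t)₊ᵐ`. -/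
noncomputable def cutoffPoly (P : ℝ[X]) (m : ℕ) (t : ℝ) : ℝ := P.eval t * max 0 (1 - t) ^ m

theorem continuous_cutoffPoly (P : ℝ[X]) (m : ℕ) : Continuous (cutoffPoly P m) :=
  P.continuous.mul (by fun_prop)

theorem cutoffPoly_eq_zero (P : ℝ[X]) {m : ℕ} (hm : m ≠ 0) {t : ℝ} (ht : 1 ≤ t) :
    cutoffPoly P m t = 0 := by
  rw [cutoffPoly, max_eq_left (by linarith), zero_pow hm, mul_zero]

/-- Brings profiles with different powers to a common one, so that the family is closed under
differentiation and under the radial operator. -/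
theorem cutoffPoly_one_sub_X_mul (P : ℝ[X]) {m : ℕ} (hm : m ≠ 0) :
    cutoffPoly ((1 - X) * P) m = cutoffPoly P (m + 1) := by
  ext t
  rcases le_total 1 t with ht | ht
  · rw [cutoffPoly_eq_zero _ hm ht, cutoffPoly_eq_zero _ (by omega) ht]
  · simp only [cutoffPoly, eval_mul, eval_sub, eval_one, eval_X,
      max_eq_right (by linarith : (0 : ℝ) ≤ 1 - t)]
    ring

/-- The polynomial factor of the derivative of `cutoffPoly P m`. -/
noncomputable def cutoffDeriv (m : ℕ) (P : ℝ[X]) : ℝ[X] :=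
  (1 - X) * derivative P - C (m : ℝ) * P

theorem hasDerivAt_cutoffPoly (P : ℝ[X]) (m : ℕ) (t : ℝ) :
    HasDerivAt (cutoffPoly P (m + 2)) (cutoffPoly (cutoffDeriv (m + 2) P) (m + 1) t) t := by
  have h1 := (hasDerivAt_posPart_pow m (1 - t)).comp t ((hasDerivAt_id t).const_sub 1)
  refine ((P.hasDerivAt t).mul h1).congr_deriv ?_
  have h2 := congrFun (cutoffPoly_one_sub_X_mul (derivative P) (Nat.succ_ne_zero m)) t
  simp only [cutoffPoly, cutoffDeriv, eval_mul, eval_sub, eval_one, eval_X, eval_C,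
    Function.comp, Nat.succ_eq_add_one] at h2 ⊢
  push_cast
  linear_combination -h2

/-- The polynomial factor of `-(4 t g'' + 2 D g')` for `g = cutoffPoly P (m + 3)`. -/
noncomputable def cutoffLaplacian (D : ℝ) (m : ℕ) (P : ℝ[X]) : ℝ[X] :=
  -(4 * X * cutoffDeriv (m + 2) (cutoffDeriv (m + 3) P) +
    C (2 * D) * ((1 - X) * cutoffDeriv (m + 3) P))

theorem cutoffPoly_cutoffLaplacian (D : ℝ) (m : ℕ) (P : ℝ[X]) (t : ℝ) :
    cutoffPoly (cutoffLaplacian D m P) (m + 1) t =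
      -(4 * t * cutoffPoly (cutoffDeriv (m + 2) (cutoffDeriv (m + 3) P)) (m + 1) t +
        2 * D * cutoffPoly (cutoffDeriv (m + 3) P) (m + 2) t) := by
  have h2 := congrFun (cutoffPoly_one_sub_X_mul (cutoffDeriv (m + 3) P) (Nat.succ_ne_zero m)) t
  rw [← h2]
  simp only [cutoffPoly, cutoffLaplacian, eval_mul, eval_sub, eval_one, eval_X, eval_C, eval_neg,
    eval_add, eval_ofNat, Nat.succ_eq_add_one]
  ring

theorem exists_abs_cutoffPoly_le (P : ℝ[X]) {m : ℕ} (hm : m ≠ 0) :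
    ∃ C, 0 ≤ C ∧ ∀ t, 0 ≤ t → |cutoffPoly P m t| ≤ C * max 0 (1 - t) ^ m := by
  obtain ⟨C, hC⟩ := (isCompact_Icc (a := (0 : ℝ)) (b := 1)).exists_bound_of_continuousOn
    P.continuous.continuousOn
  refine ⟨max 0 C, le_max_left _ _, fun t ht => ?_⟩
  rcases le_total 1 t with h1 | h1
  · rw [cutoffPoly_eq_zero _ hm h1, abs_zero]
    positivity
  · rw [cutoffPoly, abs_mul, abs_of_nonneg (a := max 0 (1 - t) ^ m) (by positivity)]
    gcongr
    exact (hC t ⟨ht, h1⟩).trans (le_max_right _ _)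

/-- Young's inequality with a small constant, without the conjugate exponent. -/
theorem exists_mul_le_half_rpow_add {α : ℝ} (hα : 1 < α) {C : ℝ} (hC : 0 ≤ C) :
    ∃ C', 0 ≤ C' ∧ ∀ y, 0 ≤ y → C * y ≤ y ^ α / 2 + C' := by
  -- The threshold beyond which `2C ≤ y^(α-1)`, hence `C y ≤ y^α / 2`; below it `C y ≤ C y₀`.
  set y₀ : ℝ := (2 * C) ^ (α - 1)⁻¹ with hy₀
  have hy₀' : 0 ≤ y₀ := by positivity
  refine ⟨C * y₀, by positivity, fun y hy => ?_⟩
  rcases le_total y y₀ with h | h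
  · have := mul_le_mul_of_nonneg_left h hC
    have := Real.rpow_nonneg hy α
    linarith
  · rcases hy.eq_or_lt with rfl | hy'
    · have := Real.rpow_nonneg hy α
      have : 0 ≤ C * y₀ := by positivity
      linarith
    have h1 : 2 * C ≤ y ^ (α - 1) := by
      have := Real.rpow_le_rpow hy₀' h (by linarith : 0 ≤ α - 1)
      rwa [hy₀, ← Real.rpow_mul (by positivity), inv_mul_cancel₀ (by linarith),
        Real.rpow_one] at this
    have h2 : y ^ α = y ^ (α - 1) * y := by
      rw [← Real.rpow_add_one hy'.ne']
      ring_nf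
    have : 0 ≤ C * y₀ := by positivity
    nlinarith

/-- Put `s = (1 - t)₊ ≤ 1`. The profile is at most a constant times `sᵐ`, and Young's inequality for
`y sᵐ` produces `y^α s^(mα)`, which is at most `y^α sᵏ` because `k ≤ mα`. The constant is uniform in
`t`, hence later in the scale. -/
theorem exists_mul_abs_cutoffPoly_le {α : ℝ} (hα : 1 < α) (P : ℝ[X]) {m k : ℕ} (hm : m ≠ 0)
    (hk0 : k ≠ 0) (hk : (k : ℝ) ≤ m * α) :
    ∃ C, 0 ≤ C ∧ ∀ t, 0 ≤ t → ∀ y, 0 ≤ y →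
      y * |cutoffPoly P m t| ≤ y ^ α * cutoffPoly 1 k t / 2 + C := by
  obtain ⟨C₁, hC₁, h₁⟩ := exists_abs_cutoffPoly_le P hm
  obtain ⟨C₂, hC₂, h₂⟩ := exists_mul_le_half_rpow_add hα hC₁
  refine ⟨C₂, hC₂, fun t ht y hy => ?_⟩
  have hs0 : (0 : ℝ) ≤ max 0 (1 - t) := le_max_left _ _
  have hs1 : max 0 (1 - t) ≤ 1 := max_le zero_le_one (by linarith)
  have h3 := h₂ (y * max 0 (1 - t) ^ m) (by positivity)
  have h4 : (y * max 0 (1 - t) ^ m) ^ α ≤ y ^ α * cutoffPoly 1 k t := by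
    rw [Real.mul_rpow hy (by positivity), cutoffPoly, eval_one, one_mul,
      ← Real.rpow_natCast _ m, ← Real.rpow_mul hs0, ← Real.rpow_natCast _ k]
    gcongr y ^ α * ?_
    rcases hs0.eq_or_lt with h0 | h0
    · have : (m : ℝ) * α ≠ 0 := mul_ne_zero (by exact_mod_cast hm) (by linarith)
      rw [← h0, Real.zero_rpow this, Real.zero_rpow (by exact_mod_cast hk0)]
    · exact Real.rpow_le_rpow_of_exponent_ge h0 hs1 hk
  have h5 : y * |cutoffPoly P m t| ≤ C₁ * (y * max 0 (1 - t) ^ m) := by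
    have := mul_le_mul_of_nonneg_left (h₁ t ht) hy
    linarith
  linarith

/-! ### Rescaled test functions -/

/-- The Bessel translation to `x₀` of the function `x ↦ cutoffPoly P m (lam |x|²)`, which is
supported in the ball of radius `lam ^ (-1/2)`. -/
noncomputable def scaledCutoff (a : ℝ) (x₀ : EuclideanSpace ℝ (Fin (n + 1))) (P : ℝ[X]) (m : ℕ)
    (lam : ℝ) : EuclideanSpace ℝ (Fin (n + 1)) → ℝ :=
  besselMean a x₀ fun t => cutoffPoly P m (lam * t)

theorem continuous_scaledCutoff {a : ℝ} (ha : 1 ≤ a) (x₀ : EuclideanSpace ℝ (Fin (n + 1)))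
    (P : ℝ[X]) (m : ℕ) (lam : ℝ) : Continuous (scaledCutoff a x₀ P m lam) :=
  (contDiff_besselMean (m := 0) ha x₀ (contDiff_zero.2
    ((continuous_cutoffPoly P m).comp (continuous_const.mul continuous_id)))).continuous

theorem scaledCutoff_eq_zero (a : ℝ) {x₀ x : EuclideanSpace ℝ (Fin (n + 1))} (P : ℝ[X]) {m : ℕ}
    (hm : m ≠ 0) {lam : ℝ} (hlam : 0 < lam) (hx : ‖x₀‖ + √(1 / lam) ≤ ‖x‖) :
    scaledCutoff a x₀ P m lam x = 0 := by
  refine besselMean_eq_zero a (Real.sqrt_nonneg _) (fun t ht => cutoffPoly_eq_zero P hm ?_) hx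
  rw [Real.sq_sqrt (by positivity), div_le_iff₀ hlam] at ht
  linarith

theorem hasCompactSupport_scaledCutoff (a : ℝ) (x₀ : EuclideanSpace ℝ (Fin (n + 1))) (P : ℝ[X])
    {m : ℕ} (hm : m ≠ 0) {lam : ℝ} (hlam : 0 < lam) :
    HasCompactSupport (scaledCutoff a x₀ P m lam) := by
  refine hasCompactSupport_besselMean a x₀ (Real.sqrt_nonneg (1 / lam))
    fun t ht => cutoffPoly_eq_zero P hm ?_
  rw [Real.sq_sqrt (by positivity), div_le_iff₀ hlam] at ht
  linarith

theorem hasDerivAt_cutoffPoly_mul (P : ℝ[X]) (m : ℕ) (lam t : ℝ) :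
    HasDerivAt (fun t => cutoffPoly P (m + 2) (lam * t))
      (lam * cutoffPoly (cutoffDeriv (m + 2) P) (m + 1) (lam * t)) t := by
  have h := (hasDerivAt_cutoffPoly P m (lam * t)).comp t ((hasDerivAt_id' t).const_mul lam)
  refine h.congr_deriv ?_
  ring

theorem contDiff_scaledCutoff {a : ℝ} (ha : 1 ≤ a) (x₀ : EuclideanSpace ℝ (Fin (n + 1)))
    (P : ℝ[X]) (m : ℕ) (lam : ℝ) : ContDiff ℝ (2 : ℕ) (scaledCutoff a x₀ P (m + 3) lam) :=
  contDiff_besselMean ha x₀ (contDiff_two_of_hasDerivAt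
    (fun t => hasDerivAt_cutoffPoly_mul P (m + 1) lam t)
    (fun t => (hasDerivAt_cutoffPoly_mul (cutoffDeriv (m + 3) P) m lam t).const_mul lam)
    (continuous_const.mul (continuous_const.mul
      ((continuous_cutoffPoly _ _).comp (continuous_const.mul continuous_id)))))

theorem negWeightedLaplacian_scaledCutoff {a : ℝ} (ha : 1 ≤ a)
    (x₀ : EuclideanSpace ℝ (Fin (n + 1))) (P : ℝ[X]) (m : ℕ) (lam : ℝ)
    {x : EuclideanSpace ℝ (Fin (n + 1))} (hx : x (Fin.last n) ≠ 0) :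
    negWeightedLaplacian a (scaledCutoff a x₀ P (m + 3) lam) x =
      lam * scaledCutoff a x₀ (cutoffLaplacian (n + 2 * a) m P) (m + 1) lam x := by
  unfold scaledCutoff
  rw [negWeightedLaplacian_besselMean ha x₀
    (fun t => hasDerivAt_cutoffPoly_mul P (m + 1) lam t)
    (fun t => (hasDerivAt_cutoffPoly_mul (cutoffDeriv (m + 3) P) m lam t).const_mul lam)
    (continuous_const.mul (continuous_const.mul
      ((continuous_cutoffPoly _ _).comp (continuous_const.mul continuous_id)))) hx]
  unfold besselMean
  rw [← intervalIntegral.integral_const_mul]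
  refine intervalIntegral.integral_congr fun θ _ => ?_
  beta_reduce
  rw [cutoffPoly_cutoffLaplacian]
  ring

theorem integral_negWeightedLaplacian_mul_scaledCutoff {a : ℝ} (ha : 1 ≤ a)
    (x₀ : EuclideanSpace ℝ (Fin (n + 1))) (P : ℝ[X]) (m : ℕ) {lam : ℝ} (hlam : 0 < lam)
    {f : EuclideanSpace ℝ (Fin (n + 1)) → ℝ} (hf : ContDiff ℝ (2 : ℕ) f) (he : EvenInLast f) :
    ∫ x, negWeightedLaplacian a f x * scaledCutoff a x₀ P (m + 3) lam x * weight a x =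
      lam * ∫ x, f x * scaledCutoff a x₀ (cutoffLaplacian (n + 2 * a) m P) (m + 1) lam x *
        weight a x := by
  rw [integral_negWeightedLaplacian_mul_comm ha hf he (contDiff_scaledCutoff ha x₀ P m lam)
    (evenInLast_besselMean a x₀ _) (hasCompactSupport_scaledCutoff a x₀ P (by omega) hlam),
    ← integral_const_mul]
  refine integral_congr_ae (Eventually.of_forall fun x => ?_)
  beta_reduce
  -- The intertwining formula is available only off the hyperplane, but on it the weight vanishes.
  by_cases hx : x (Fin.last n) = 0
  · simp [weight_eq_zero ha hx]
  · rw [negWeightedLaplacian_scaledCutoff ha x₀ P m lam hx]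
    ring

/-- Each transfer of the operator to the test function costs two powers of the cutoff and gains a
factor `lam`. That `Q` is chosen before `x₀`, `lam` and `f` makes the later constants independent of
the scale. -/
theorem exists_integral_iterate_mul_scaledCutoff {a : ℝ} (ha : 1 ≤ a) (m i : ℕ) (P : ℝ[X]) :
    ∃ Q : ℝ[X], ∀ (x₀ : EuclideanSpace ℝ (Fin (n + 1))) (lam : ℝ), 0 < lam →
      ∀ f : EuclideanSpace ℝ (Fin (n + 1)) → ℝ, ContDiff ℝ (2 * i : ℕ) f → EvenInLast f →
      ∫ x, (negWeightedLaplacian a)^[i] f x * scaledCutoff a x₀ P (m + 2 * i + 1) lam x *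
        weight a x =
      lam ^ i * ∫ x, f x * scaledCutoff a x₀ Q (m + 1) lam x * weight a x := by
  induction i generalizing P with
  | zero => exact ⟨P, fun x₀ lam _ f _ _ => by simp⟩
  | succ i ih =>
    obtain ⟨Q, hQ⟩ := ih (cutoffLaplacian (n + 2 * a) (m + 2 * i) P)
    refine ⟨Q, fun x₀ lam hlam f hf he => ?_⟩
    obtain ⟨h1, h2⟩ := contDiff_iterate_negWeightedLaplacian a i (m := 2)
      (by rw [show 2 + 2 * i = 2 * (i + 1) by ring]; exact hf) he
    rw [Function.iterate_succ_apply', show m + 2 * (i + 1) + 1 = m + 2 * i + 3 by ring,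
      integral_negWeightedLaplacian_mul_scaledCutoff ha x₀ P (m + 2 * i) hlam h1 h2,
      hQ x₀ lam hlam f (hf.of_le (by exact_mod_cast (by omega))) he]
    ring

/-- One ball serves all scales whose supports it contains, so integrals can be compared and
differentiated in `lam` over a fixed compact set. -/
theorem setIntegral_mul_scaledCutoff_mul_weight (a : ℝ)
    (x₀ : EuclideanSpace ℝ (Fin (n + 1))) (P : ℝ[X]) {m : ℕ} (hm : m ≠ 0) {lam R : ℝ}
    (hlam : 0 < lam) (hR : ‖x₀‖ + √(1 / lam) ≤ R) (f : EuclideanSpace ℝ (Fin (n + 1)) → ℝ) :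
    ∫ x in Metric.closedBall 0 R, f x * scaledCutoff a x₀ P m lam x * weight a x =
      ∫ x, f x * scaledCutoff a x₀ P m lam x * weight a x := by
  refine setIntegral_eq_integral_of_forall_compl_eq_zero fun x hx => ?_
  rw [mem_closedBall_zero_iff, not_le] at hx
  rw [scaledCutoff_eq_zero a P hm hlam (hR.trans hx.le), mul_zero, zero_mul]

theorem scaledCutoff_one_nonneg (a : ℝ) (x₀ x : EuclideanSpace ℝ (Fin (n + 1))) (m : ℕ)
    (lam : ℝ) : 0 ≤ scaledCutoff a x₀ 1 m lam x := by
  refine intervalIntegral.integral_nonneg Real.pi_pos.le fun θ hθ => mul_nonneg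
    (Real.rpow_nonneg (Real.sin_nonneg_of_mem_Icc hθ) _) ?_
  simp only [cutoffPoly, eval_one, one_mul]
  positivity

/-- The pointwise Young estimate is integrated in `θ`; `sin^(2a-2) θ ≤ 1` turns the constant into `π
C`. -/
theorem mul_abs_scaledCutoff_le {a α : ℝ} (ha : 1 ≤ a) (x₀ x : EuclideanSpace ℝ (Fin (n + 1)))
    {P : ℝ[X]} {m k : ℕ} {C lam y : ℝ} (hlam : 0 < lam) (hy : 0 ≤ y)
    (hC0 : 0 ≤ C) (hC : ∀ t, 0 ≤ t → ∀ y, 0 ≤ y →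
      y * |cutoffPoly P m t| ≤ y ^ α * cutoffPoly 1 k t / 2 + C) :
    y * |scaledCutoff a x₀ P m lam x| ≤
      y ^ α * scaledCutoff a x₀ 1 k lam x / 2 + Real.pi * C := by
  have hk : Continuous fun θ : ℝ => Real.sin θ ^ (2 * a - 2) := continuous_sin_rpow (by linarith)
  have hq := continuous_besselSqDist_right x₀ x
  have hc : ∀ (P : ℝ[X]) (m : ℕ), Continuous fun θ => Real.sin θ ^ (2 * a - 2) *
      cutoffPoly P m (lam * besselSqDist x₀ x θ) := fun P m =>
    hk.mul ((continuous_cutoffPoly P m).comp (continuous_const.mul hq))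
  calc y * |scaledCutoff a x₀ P m lam x|
      ≤ y * ∫ θ in (0 : ℝ)..Real.pi, |Real.sin θ ^ (2 * a - 2) *
          cutoffPoly P m (lam * besselSqDist x₀ x θ)| :=
        mul_le_mul_of_nonneg_left
          (intervalIntegral.abs_integral_le_integral_abs Real.pi_pos.le) hy
    _ = ∫ θ in (0 : ℝ)..Real.pi, y * |Real.sin θ ^ (2 * a - 2) *
          cutoffPoly P m (lam * besselSqDist x₀ x θ)| :=
        (intervalIntegral.integral_const_mul _ _).symm
    _ ≤ ∫ θ in (0 : ℝ)..Real.pi, (y ^ α / 2 * (Real.sin θ ^ (2 * a - 2) *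
          cutoffPoly 1 k (lam * besselSqDist x₀ x θ)) + C) := by
        refine intervalIntegral.integral_mono_on Real.pi_pos.le
          ((continuous_const.mul (hc P m).abs).intervalIntegrable _ _)
          (((continuous_const.mul (hc 1 k)).add continuous_const).intervalIntegrable _ _)
          fun θ hθ => ?_
        have hs0 := Real.sin_nonneg_of_mem_Icc hθ
        have hs : 0 ≤ Real.sin θ ^ (2 * a - 2) := Real.rpow_nonneg hs0 _
        have hs1 : Real.sin θ ^ (2 * a - 2) ≤ 1 :=
          Real.rpow_le_one hs0 (Real.sin_le_one θ) (by linarith)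
        have h := hC (lam * besselSqDist x₀ x θ)
          (mul_nonneg hlam.le (besselSqDist_nonneg x₀ x θ)) y hy
        rw [abs_mul, abs_of_nonneg hs]
        have h1 := mul_le_mul_of_nonneg_left h hs
        have h2 := mul_le_mul_of_nonneg_right hs1 hC0
        nlinarith
    _ = y ^ α * scaledCutoff a x₀ 1 k lam x / 2 + Real.pi * C := by
        have hi : IntervalIntegrable (fun θ => y ^ α / 2 * (Real.sin θ ^ (2 * a - 2) *
            cutoffPoly 1 k (lam * besselSqDist x₀ x θ))) volume 0 Real.pi :=
          (continuous_const.mul (hc 1 k)).intervalIntegrable _ _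
        rw [intervalIntegral.integral_add hi intervalIntegrable_const, intervalIntegral.integral_const_mul,
          intervalIntegral.integral_const, sub_zero, smul_eq_mul, scaledCutoff, besselMean]
        ring

/-! ### Mass of balls and monotonicity in the scale -/

/-- The mass of the weighted measure in the ball around the origin which contains the support of
`scaledCutoff`. -/
theorem exists_setIntegral_weight_le {a : ℝ} (ha : 1 ≤ a)
    (x₀ : EuclideanSpace ℝ (Fin (n + 1))) :
    ∃ C, 0 ≤ C ∧ ∀ lam, 0 < lam → lam ≤ 1 →
      lam ^ ((n + 2 * a) / 2) *
        ∫ x in Metric.closedBall (0 : EuclideanSpace ℝ (Fin (n + 1))) (‖x₀‖ + √(1 / lam)),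
          weight a x ≤ C := by
  set V : ℝ := volume.real (Metric.closedBall (0 : EuclideanSpace ℝ (Fin (n + 1))) 1)
  -- On the ball of radius `R = ‖x₀‖ + ρ` the weight is at most `R^(2a-1)` and the volume is
  -- `R^(n+1) V`. As `ρ ≥ 1`, `R ≤ (‖x₀‖ + 1) ρ`, and `ρ^(n+2a)` cancels the power of `lam`.
  refine ⟨(‖x₀‖ + 1) ^ (n + 2 * a) * V, by positivity, fun lam h0 h1 => ?_⟩
  set ρ : ℝ := √(1 / lam) with hρ
  have hρ1 : 1 ≤ ρ := by
    rw [hρ, Real.one_le_sqrt, le_div_iff₀ h0]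
    linarith
  set R : ℝ := ‖x₀‖ + ρ with hR
  have hR0 : 0 < R := by positivity
  have hRρ : R ≤ (‖x₀‖ + 1) * ρ := by nlinarith [norm_nonneg x₀]
  have hV : volume.real (Metric.closedBall (0 : EuclideanSpace ℝ (Fin (n + 1))) R) =
      R ^ (n + 1) * V := by
    have := Measure.addHaar_real_closedBall' volume
      (0 : EuclideanSpace ℝ (Fin (n + 1))) hR0.le
    simpa using this
  have hI : ∫ x in Metric.closedBall (0 : EuclideanSpace ℝ (Fin (n + 1))) R, weight a x ≤
      R ^ (2 * a - 1) * (R ^ (n + 1) * V) := by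
    rw [← hV]
    refine (Real.le_norm_self _).trans (norm_setIntegral_le_of_norm_le_const
      (isCompact_closedBall _ _).measure_lt_top fun x hx => ?_)
    rw [Real.norm_of_nonneg (weight_nonneg a x)]
    refine Real.rpow_le_rpow (abs_nonneg _) ?_ (by linarith)
    exact (PiLp.norm_apply_le x (Fin.last n)).trans (mem_closedBall_zero_iff.1 hx)
  have hpow : R ^ (2 * a - 1) * R ^ (n + 1) = R ^ ((n : ℝ) + 2 * a) := by
    rw [← Real.rpow_natCast, ← Real.rpow_add hR0]
    push_cast
    ring_nf
  have hlam : lam ^ (((n : ℝ) + 2 * a) / 2) * ρ ^ ((n : ℝ) + 2 * a) = 1 := by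
    have hl : lam = (ρ⁻¹) ^ (2 : ℝ) := by
      rw [Real.rpow_two, inv_pow, hρ, Real.sq_sqrt (by positivity)]
      simp
    rw [hl, ← Real.rpow_mul (by positivity), mul_div_cancel₀ _ two_ne_zero,
      ← Real.mul_rpow (by positivity) (by positivity), inv_mul_cancel₀ (by positivity),
      Real.one_rpow]
  have hD : 0 ≤ (n : ℝ) + 2 * a := by positivity
  calc lam ^ (((n : ℝ) + 2 * a) / 2) * ∫ x in Metric.closedBall
        (0 : EuclideanSpace ℝ (Fin (n + 1))) R, weight a x
      ≤ lam ^ (((n : ℝ) + 2 * a) / 2) * (R ^ ((n : ℝ) + 2 * a) * V) := by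
        rw [← hpow, mul_assoc (R ^ (2 * a - 1))]
        gcongr
    _ ≤ lam ^ (((n : ℝ) + 2 * a) / 2) * (((‖x₀‖ + 1) * ρ) ^ ((n : ℝ) + 2 * a) * V) := by
        gcongr
    _ = (‖x₀‖ + 1) ^ (n + 2 * a) * V := by
        rw [Real.mul_rpow (by positivity) (by positivity)]
        linear_combination ((‖x₀‖ + 1) ^ (n + 2 * a) * V) * hlam

theorem hasDerivAt_setIntegral_mul_scaledCutoff {a : ℝ} (ha : 1 ≤ a)
    (x₀ : EuclideanSpace ℝ (Fin (n + 1))) (P : ℝ[X]) (m : ℕ) (R : ℝ)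
    {v : EuclideanSpace ℝ (Fin (n + 1)) → ℝ} (hv : Continuous v) (lam : ℝ) :
    HasDerivAt (fun lam => ∫ x in Metric.closedBall (0 : EuclideanSpace ℝ (Fin (n + 1))) R,
        v x * scaledCutoff a x₀ P (m + 2) lam x * weight a x)
      (∫ x in Metric.closedBall (0 : EuclideanSpace ℝ (Fin (n + 1))) R,
        v x * besselMean a x₀ (fun t => t * cutoffPoly (cutoffDeriv (m + 2) P) (m + 1) (lam * t)) x
          * weight a x) lam := by
  have hk : Continuous fun θ : ℝ => Real.sin θ ^ (2 * a - 2) := continuous_sin_rpow (by linarith)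
  have hq := continuous_besselSqDist x₀
  have hg := continuous_cutoffPoly (cutoffDeriv (m + 2) P) (m + 1)
  have hg0 := continuous_cutoffPoly P (m + 2)
  have hw : Continuous (weight a : EuclideanSpace ℝ (Fin (n + 1)) → ℝ) := continuous_weight ha
  refine hasDerivAt_setIntegral_of_isCompact (isCompact_closedBall _ _)
    (F := fun lam x => v x * scaledCutoff a x₀ P (m + 2) lam x * weight a x)
    (F' := fun lam x => v x * besselMean a x₀
      (fun t => t * cutoffPoly (cutoffDeriv (m + 2) P) (m + 1) (lam * t)) x * weight a x)
    (fun lam => (hv.mul (continuous_scaledCutoff ha x₀ P _ lam)).mul hw) ?_ (fun lam x => ?_) lam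
  · refine ((hv.comp continuous_snd).mul ?_).mul (hw.comp continuous_snd)
    have hq2 : Continuous fun z : (ℝ × EuclideanSpace ℝ (Fin (n + 1))) × ℝ =>
        besselSqDist x₀ z.1.2 z.2 :=
      hq.comp (f := fun z : (ℝ × EuclideanSpace ℝ (Fin (n + 1))) × ℝ => (z.1.2, z.2))
        (by fun_prop)
    refine intervalIntegral.continuous_parametric_intervalIntegral_of_continuous'
      (f := fun (z : ℝ × EuclideanSpace ℝ (Fin (n + 1))) θ => Real.sin θ ^ (2 * a - 2) *
        (besselSqDist x₀ z.2 θ * cutoffPoly (cutoffDeriv (m + 2) P) (m + 1)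
          (z.1 * besselSqDist x₀ z.2 θ))) ?_ 0 Real.pi
    exact (hk.comp continuous_snd).mul (hq2.mul
      (hg.comp ((continuous_fst.comp continuous_fst).mul hq2)))
  · refine HasDerivAt.mul_const (HasDerivAt.const_mul _ ?_) _
    have hqx := continuous_besselSqDist_right x₀ x
    refine hasDerivAt_intervalIntegral_param Real.pi_pos.le
      (F := fun lam θ => Real.sin θ ^ (2 * a - 2) *
        cutoffPoly P (m + 2) (lam * besselSqDist x₀ x θ))
      (F' := fun lam θ => Real.sin θ ^ (2 * a - 2) *
        (besselSqDist x₀ x θ * cutoffPoly (cutoffDeriv (m + 2) P) (m + 1)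
          (lam * besselSqDist x₀ x θ)))
      (fun lam => hk.mul (hg0.comp (continuous_const.mul hqx))) ?_ (fun lam θ => ?_) lam
    · exact (hk.comp continuous_snd).mul ((hqx.comp continuous_snd).mul
        (hg.comp (continuous_fst.mul (hqx.comp continuous_snd))))
    · have h := (hasDerivAt_cutoffPoly P m (lam * besselSqDist x₀ x θ)).comp lam
        ((hasDerivAt_id' lam).mul_const (besselSqDist x₀ x θ))
      refine (h.const_mul _).congr_deriv ?_
      ring

/-- The operator maps a primitive of the profile `(1 - t)₊ᵐ⁺²` to the derivative of its dilations
with respect to the scale. -/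
theorem scaledCutoff_cutoffLaplacian_eq {a : ℝ} (ha : 1 ≤ a)
    (x₀ x : EuclideanSpace ℝ (Fin (n + 1))) (D : ℝ) (m : ℕ) (lam : ℝ) :
    scaledCutoff a x₀ (cutoffLaplacian D m (C ((m + 3 : ℝ)⁻¹))) (m + 1) lam x =
      4 * lam * besselMean a x₀
        (fun t => t * cutoffPoly (cutoffDeriv (m + 2) 1) (m + 1) (lam * t)) x +
      2 * D * scaledCutoff a x₀ 1 (m + 2) lam x := by
  have hk : Continuous fun θ : ℝ => Real.sin θ ^ (2 * a - 2) := continuous_sin_rpow (by linarith)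
  have hqx := continuous_besselSqDist_right x₀ x
  have hg := continuous_cutoffPoly (cutoffDeriv (m + 2) 1) (m + 1)
  have hg0 := continuous_cutoffPoly 1 (m + 2)
  have h3 : (m + 3 : ℝ) ≠ 0 := by positivity
  -- The profile `(1-t)₊^(m+3) / (m+3)` has derivative `-G` with `G = (1-t)₊^(m+2)`, so the radial
  -- operator turns it into `4 t G' + 2 D G`. At `lam t` this is `4 lam^(1-D/2)` times the
  -- `lam`-derivative of `lam^(D/2) G(lam t)`.
  have e1 : cutoffDeriv (m + 3) (C ((m + 3 : ℝ)⁻¹)) = -1 := by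
    rw [cutoffDeriv, derivative_C, mul_zero, zero_sub, ← C_mul]
    push_cast
    rw [mul_inv_cancel₀ h3, C_1]
  have e2 : cutoffDeriv (m + 2) (-1) = -cutoffDeriv (m + 2) 1 := by
    simp [cutoffDeriv]
  have e3 : ∀ (P : ℝ[X]) (k : ℕ) (t : ℝ), cutoffPoly (-P) k t = -cutoffPoly P k t := by
    intro P k t
    simp [cutoffPoly]
  unfold scaledCutoff besselMean
  rw [← intervalIntegral.integral_const_mul, ← intervalIntegral.integral_const_mul,
    ← intervalIntegral.integral_add]
  · refine intervalIntegral.integral_congr fun θ _ => ?_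
    beta_reduce
    rw [cutoffPoly_cutoffLaplacian, e1, e2, e3, e3]
    ring
  · exact (continuous_const.mul (hk.mul (hqx.mul
      (hg.comp (continuous_const.mul hqx))))).intervalIntegrable _ _
  · exact (continuous_const.mul (hk.mul
      (hg0.comp (continuous_const.mul hqx)))).intervalIntegrable _ _

theorem continuous_besselMean {a : ℝ} (ha : 1 ≤ a) (x₀ : EuclideanSpace ℝ (Fin (n + 1)))
    {h : ℝ → ℝ} (hh : Continuous h) : Continuous (besselMean a x₀ h) :=
  (contDiff_besselMean (m := 0) ha x₀ (contDiff_zero.2 hh)).continuous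

/-- Smoothed averages of a weighted superharmonic function increase as the scale decreases. -/
theorem monotoneOn_rpow_mul_integral_scaledCutoff {a : ℝ} (ha : 1 ≤ a)
    (x₀ : EuclideanSpace ℝ (Fin (n + 1))) (m : ℕ)
    {v : EuclideanSpace ℝ (Fin (n + 1)) → ℝ} (hv : ContDiff ℝ (2 : ℕ) v) (he : EvenInLast v)
    (hL : ∀ x, 0 ≤ negWeightedLaplacian a v x) :
    MonotoneOn (fun lam => lam ^ ((n + 2 * a) / 2) *
      ∫ x, v x * scaledCutoff a x₀ 1 (m + 2) lam x * weight a x) (Ioi 0) := by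
  have hw : Continuous (weight a : EuclideanSpace ℝ (Fin (n + 1)) → ℝ) := continuous_weight ha
  have key : ∀ lam ∈ Ioi (0 : ℝ), ∃ J', 0 ≤ J' ∧ HasDerivAt (fun lam => lam ^ ((n + 2 * a) / 2) *
      ∫ x, v x * scaledCutoff a x₀ 1 (m + 2) lam x * weight a x) J' lam := by
    intro lam hlam
    have hlam0 : 0 < lam := hlam
    -- The radius for `lam / 2` covers the supports at all scales in a neighbourhood of `lam`.
    set R : ℝ := ‖x₀‖ + √(1 / (lam / 2)) with hR
    set B := Metric.closedBall (0 : EuclideanSpace ℝ (Fin (n + 1))) R with hB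
    have hRl : ∀ l, lam / 2 ≤ l → ‖x₀‖ + √(1 / l) ≤ R := fun l hl => by
      rw [hR]
      gcongr
    set S := besselMean a x₀
      (fun t => t * cutoffPoly (cutoffDeriv (m + 2) 1) (m + 1) (lam * t)) with hS
    have hScont : Continuous S := continuous_besselMean ha x₀
      (continuous_id.mul ((continuous_cutoffPoly _ _).comp (continuous_const.mul continuous_id)))
    have hN := hasDerivAt_setIntegral_mul_scaledCutoff ha x₀ 1 m R hv.continuous lam
    have hN' : HasDerivAt (fun lam => ∫ x, v x * scaledCutoff a x₀ 1 (m + 2) lam x * weight a x)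
        (∫ x in B, v x * S x * weight a x) lam := by
      refine hN.congr_of_eventuallyEq ?_
      filter_upwards [Ioi_mem_nhds (by linarith : lam / 2 < lam)] with l hl
      have hl' : lam / 2 < l := hl
      exact (setIntegral_mul_scaledCutoff_mul_weight a x₀ 1 (by omega) (by linarith)
        (hRl l hl'.le) v).symm
    refine ⟨_, ?_, (Real.hasDerivAt_rpow_const (p := (n + 2 * a) / 2)
      (Or.inl hlam0.ne')).mul hN'⟩
    -- Testing superharmonicity with the primitive profile gives `4 lam N' + 2 D N ≥ 0` for the
    -- unnormalized integral `N`, which is the sign of the derivative of `lam^(D/2) N`.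
    have h1 := integral_negWeightedLaplacian_mul_scaledCutoff ha x₀ (C ((m + 3 : ℝ)⁻¹)) m hlam0
      hv he
    have h2 : 0 ≤ ∫ x, negWeightedLaplacian a v x *
        scaledCutoff a x₀ (C ((m + 3 : ℝ)⁻¹)) (m + 3) lam x * weight a x := by
      refine integral_nonneg fun x => mul_nonneg (mul_nonneg (hL x) ?_) (weight_nonneg a x)
      refine intervalIntegral.integral_nonneg Real.pi_pos.le fun θ hθ => mul_nonneg
        (Real.rpow_nonneg (Real.sin_nonneg_of_mem_Icc hθ) _) ?_
      simp only [cutoffPoly, eval_C]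
      positivity
    have h3 : ∫ x, v x * scaledCutoff a x₀ (cutoffLaplacian (n + 2 * a) m (C ((m + 3 : ℝ)⁻¹)))
        (m + 1) lam x * weight a x = 4 * lam * (∫ x in B, v x * S x * weight a x) +
        2 * (n + 2 * a) * ∫ x, v x * scaledCutoff a x₀ 1 (m + 2) lam x * weight a x := by
      rw [← setIntegral_mul_scaledCutoff_mul_weight a x₀ _ (by omega) hlam0
        (hRl lam (by linarith)) v, ← setIntegral_mul_scaledCutoff_mul_weight a x₀ 1
        (by omega : m + 2 ≠ 0) hlam0 (hRl lam (by linarith)) v, ← integral_const_mul,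
        ← integral_const_mul, ← integral_add]
      · refine integral_congr_ae (Eventually.of_forall fun x => ?_)
        beta_reduce
        rw [scaledCutoff_cutoffLaplacian_eq ha]
        ring
      · exact (continuous_const.mul ((hv.continuous.mul hScont).mul
          hw)).continuousOn.integrableOn_compact (isCompact_closedBall _ _)
      · exact (continuous_const.mul ((hv.continuous.mul
          (continuous_scaledCutoff ha x₀ 1 (m + 2) lam)).mul
          hw)).continuousOn.integrableOn_compact (isCompact_closedBall _ _)
    rw [h1, h3] at h2
    have h4 := nonneg_of_mul_nonneg_right h2 hlam0
    have h5 : lam ^ (((n : ℝ) + 2 * a) / 2) = lam ^ (((n : ℝ) + 2 * a) / 2 - 1) * lam := by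
      rw [← Real.rpow_add_one hlam0.ne']
      ring_nf
    rw [h5]
    have h6 := mul_nonneg (Real.rpow_nonneg hlam0.le (((n : ℝ) + 2 * a) / 2 - 1)) h4
    linarith
  refine monotoneOn_of_deriv_nonneg (convex_Ioi 0)
    (fun lam hlam => ?_) (fun lam hlam => ?_) fun lam hlam => ?_
  · obtain ⟨J', -, h⟩ := key lam hlam
    exact h.continuousAt.continuousWithinAt
  · rw [interior_Ioi] at hlam
    obtain ⟨J', -, h⟩ := key lam hlam
    exact h.differentiableAt.differentiableWithinAt
  · rw [interior_Ioi] at hlam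
    obtain ⟨J', h0, h⟩ := key lam hlam
    rwa [h.deriv]

/-! ### From averages to pointwise positivity -/

theorem scaledCutoff_one_pos {a : ℝ} (ha : 1 ≤ a) {x₀ x : EuclideanSpace ℝ (Fin (n + 1))} (m : ℕ)
    {lam : ℝ} (hx : lam * ‖x - x₀‖ ^ 2 < 1) : 0 < scaledCutoff a x₀ 1 m lam x := by
  have hk : Continuous fun θ : ℝ => Real.sin θ ^ (2 * a - 2) := continuous_sin_rpow (by linarith)
  have hqx := continuous_besselSqDist_right x₀ x
  have hev : ∀ᶠ θ in 𝓝[>] (0 : ℝ), lam * besselSqDist x₀ x θ < 1 :=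
    nhdsWithin_le_nhds ((continuous_const.mul hqx).continuousAt.eventually_lt continuousAt_const
      (by simpa [besselSqDist] using hx))
  obtain ⟨θ, hθ1, hθ2⟩ := (hev.and (Ioo_mem_nhdsGT Real.pi_pos)).exists
  refine intervalIntegral.integral_pos Real.pi_pos (hk.mul ((continuous_cutoffPoly 1 m).comp
    (continuous_const.mul hqx))).continuousOn (fun θ hθ => mul_nonneg
    (Real.rpow_nonneg (Real.sin_nonneg_of_mem_Icc ⟨hθ.1.le, hθ.2⟩) _) ?_)
    ⟨θ, ⟨hθ2.1.le, hθ2.2.le⟩, mul_pos (Real.rpow_pos_of_pos (Real.sin_pos_of_mem_Ioo hθ2) _) ?_⟩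
  · simp only [cutoffPoly, eval_one, one_mul]
    positivity
  · simp only [cutoffPoly, eval_one, one_mul]
    exact pow_pos (lt_max_of_lt_right (by linarith)) _

/-- A continuous even function with nonnegative smoothed averages around `x₀` is nonnegative
at `x₀`. -/
theorem nonneg_of_integral_scaledCutoff_nonneg {a : ℝ} (ha : 1 ≤ a)
    {x₀ : EuclideanSpace ℝ (Fin (n + 1))} {m : ℕ} (hm : m ≠ 0)
    {v : EuclideanSpace ℝ (Fin (n + 1)) → ℝ} (hv : Continuous v) (he : EvenInLast v)
    (hI : ∀ lam, 0 < lam → 0 ≤ ∫ x, v x * scaledCutoff a x₀ 1 m lam x * weight a x) :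
    0 ≤ v x₀ := by
  by_contra! hneg
  obtain ⟨δ, hδ, hball⟩ := Metric.eventually_nhds_iff.1
    (hv.continuousAt.eventually_lt continuousAt_const hneg)
  have hδ2 : 0 < 1 / δ ^ 2 := by positivity
  -- At scale `1 / δ²` the test function vanishes unless `x` is within `δ` of `x₀` or of its
  -- reflection; evenness makes `v` negative near both.
  have hnonpos : ∀ x, v x * scaledCutoff a x₀ 1 m (1 / δ ^ 2) x * weight a x ≤ 0 := by
    intro x
    have hnn := scaledCutoff_one_nonneg a x₀ x m (1 / δ ^ 2)
    by_cases hx : δ ^ 2 ≤ min (‖x - x₀‖ ^ 2) (‖x - reflectLast x₀‖ ^ 2)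
    · have h0 : scaledCutoff a x₀ 1 m (1 / δ ^ 2) x = 0 := by
        refine (intervalIntegral.integral_congr fun θ _ => ?_).trans
          intervalIntegral.integral_zero
        have hθ := hx.trans (min_le_besselSqDist x₀ x θ)
        beta_reduce
        rw [cutoffPoly_eq_zero 1 hm, mul_zero]
        rw [one_div, inv_mul_eq_div, le_div_iff₀ (by positivity)]
        linarith
      rw [h0, mul_zero, zero_mul]
    · have hvx : v x < 0 := by
        rw [not_le, min_lt_iff] at hx
        rcases hx with h | h
        · exact hball (by rw [dist_eq_norm]; exact lt_of_pow_lt_pow_left₀ 2 hδ.le h)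
        · rw [← he x]
          refine hball ?_
          have h1 : ‖reflectLast x - x₀‖ = ‖x - reflectLast x₀‖ := by
            rw [← norm_reflectLast (x - reflectLast x₀), ← reflectLastCLM_apply (x - _), map_sub,
              reflectLastCLM_apply, reflectLastCLM_apply, reflectLast_reflectLast]
          rw [dist_eq_norm, h1]
          exact lt_of_pow_lt_pow_left₀ 2 hδ.le h
      exact mul_nonpos_of_nonpos_of_nonneg (mul_nonpos_of_nonpos_of_nonneg hvx.le hnn)
        (weight_nonneg a x)
  -- Strict negativity of the integral needs a point off the hyperplane, where the weight is
  -- positive.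
  obtain ⟨x, hx1, hx2⟩ : ∃ x : EuclideanSpace ℝ (Fin (n + 1)), ‖x - x₀‖ < δ ∧
      x (Fin.last n) ≠ 0 := by
    by_cases h0 : x₀ (Fin.last n) = 0
    · refine ⟨x₀ + (δ / 2) • EuclideanSpace.single (Fin.last n) 1, ?_, ?_⟩
      · rw [add_sub_cancel_left, norm_smul, PiLp.norm_single]
        simp [abs_of_pos hδ, hδ]
      · simp [h0, hδ.ne']
    · exact ⟨x₀, by simpa using hδ, h0⟩
  have hcont : Continuous fun x => -(v x * scaledCutoff a x₀ 1 m (1 / δ ^ 2) x * weight a x) :=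
    ((hv.mul (continuous_scaledCutoff ha x₀ 1 m _)).mul (continuous_weight ha)).neg
  have hpos := hcont.integral_pos_of_hasCompactSupport_nonneg_nonzero (μ := volume)
    ((((hasCompactSupport_scaledCutoff a x₀ 1 hm hδ2).mul_left).mul_right).comp_left
      (g := Neg.neg) neg_zero)
    (fun x => neg_nonneg.2 (hnonpos x)) (x := x) (by
      have h1 : v x < 0 := hball (by rwa [dist_eq_norm])
      have h2 : 0 < scaledCutoff a x₀ 1 m (1 / δ ^ 2) x := scaledCutoff_one_pos ha m (by
        rw [one_div, inv_mul_lt_one₀ (by positivity)]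
        gcongr)
      have h3 : 0 < weight a x := Real.rpow_pos_of_pos (abs_pos.2 hx2) _
      exact neg_ne_zero.2 (mul_ne_zero (mul_ne_zero h1.ne h2.ne') h3.ne'))
  rw [integral_neg] at hpos
  linarith [hI _ hδ2]

/-- A negative second derivative would make the point a local maximum too, hence `g` locally
constant, a contradiction. -/
theorem _root_.IsLocalMin.deriv_deriv_nonneg {g : ℝ → ℝ} {x : ℝ} (h : IsLocalMin g x)
    (hg : ContinuousAt g x) : 0 ≤ deriv (deriv g) x := by
  by_contra! hneg
  have hmax := isLocalMax_of_deriv_deriv_neg hneg h.deriv_eq_zero hg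
  have hconst : g =ᶠ[𝓝 x] fun _ => g x := by
    filter_upwards [h, hmax] with y h1 h2 using le_antisymm h2 h1
  rw [hconst.deriv.deriv_eq] at hneg
  simp at hneg

theorem _root_.IsLocalMin.partialD_partialD_nonneg {f : EuclideanSpace ℝ (Fin (n + 1)) → ℝ}
    (hf : ContDiff ℝ (2 : ℕ) f) {x : EuclideanSpace ℝ (Fin (n + 1))} (h : IsLocalMin f x)
    (i : Fin (n + 1)) : 0 ≤ partialD i (partialD i f) x := by
  have hline : ∀ {g : EuclideanSpace ℝ (Fin (n + 1)) → ℝ}, Differentiable ℝ g → ∀ t : ℝ,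
      HasDerivAt (fun t : ℝ => g (x + t • EuclideanSpace.single i 1))
        (partialD i g (x + t • EuclideanSpace.single i 1)) t := by
    intro g hg t
    have h1 : HasDerivAt (fun t : ℝ => x + t • EuclideanSpace.single i (1 : ℝ))
        (EuclideanSpace.single i (1 : ℝ)) t := by
      simpa using ((hasDerivAt_id t).smul_const (EuclideanSpace.single i (1 : ℝ))).const_add x
    exact (hg _).hasFDerivAt.comp_hasDerivAt t h1
  have hd : Differentiable ℝ (partialD i f) :=
    (contDiff_partialD (m := 1) i hf).differentiable (by simp)
  have e1 : deriv (fun t : ℝ => f (x + t • EuclideanSpace.single i 1)) =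
      fun t : ℝ => partialD i f (x + t • EuclideanSpace.single i 1) :=
    funext fun t => (hline (hf.differentiable (by simp)) t).deriv
  have hc : Continuous fun t : ℝ => x + t • EuclideanSpace.single i (1 : ℝ) := by fun_prop
  have hmin : IsLocalMin (fun t : ℝ => f (x + t • EuclideanSpace.single i 1)) 0 := by
    have h0 : x + (0 : ℝ) • EuclideanSpace.single i (1 : ℝ) = x := by simp
    have := hc.tendsto 0
    rw [h0] at this
    filter_upwards [this.eventually h] with t ht
    rwa [h0]
  have h2 := hmin.deriv_deriv_nonneg (hf.continuous.comp hc).continuousAt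
  rw [e1, (hline hd 0).deriv] at h2
  simpa using h2

/-- Off the hyperplane the singular term vanishes with the gradient; on it, it is a second
derivative and so nonnegative. -/
theorem _root_.IsLocalMin.negWeightedLaplacian_nonpos {a : ℝ} (ha : 1 ≤ a)
    {f : EuclideanSpace ℝ (Fin (n + 1)) → ℝ} (hf : ContDiff ℝ (2 : ℕ) f)
    {x : EuclideanSpace ℝ (Fin (n + 1))} (h : IsLocalMin f x) :
    negWeightedLaplacian a f x ≤ 0 := by
  have hfd : Differentiable ℝ f := hf.differentiable (by simp)
  have hd : Differentiable ℝ (partialD (Fin.last n) f) :=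
    (contDiff_partialD (m := 1) _ hf).differentiable (by simp)
  have h1 : 0 ≤ ∑ i, partialD i (partialD i f) x :=
    Finset.sum_nonneg fun i _ => h.partialD_partialD_nonneg hf i
  have h2 : 0 ≤ singularTerm f x := by
    unfold singularTerm
    rw [partialLast_eq_partialD hfd, partialLast_eq_partialD hd]
    split_ifs
    · exact h.partialD_partialD_nonneg hf _
    · simp [partialD, h.fderiv_eq_zero]
  rw [negWeightedLaplacian, laplacian_eq_sum_partialD hf]
  have h3 : 0 ≤ (2 * a - 1) * singularTerm f x := mul_nonneg (by linarith) h2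
  linarith

/-- A function with positive weighted Laplacian whose smoothed averages vanish at infinity is
positive. -/
theorem pos_of_tendsto_integral_scaledCutoff {a : ℝ} (ha : 1 ≤ a) (m : ℕ)
    {v : EuclideanSpace ℝ (Fin (n + 1)) → ℝ} (hv : ContDiff ℝ (2 : ℕ) v) (he : EvenInLast v)
    (hL : ∀ x, 0 < negWeightedLaplacian a v x)
    (hI : ∀ x₀, Tendsto (fun lam => lam ^ ((n + 2 * a) / 2) *
      ∫ x, v x * scaledCutoff a x₀ 1 (m + 2) lam x * weight a x) (𝓝[>] 0) (𝓝 0))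
    (x₀ : EuclideanSpace ℝ (Fin (n + 1))) : 0 < v x₀ := by
  have hnn : ∀ x, 0 ≤ v x := fun x₀ =>
    nonneg_of_integral_scaledCutoff_nonneg ha (Nat.succ_ne_zero (m + 1)) hv.continuous he fun lam hlam => by
      -- A function increasing in `lam` with limit `0` at `0⁺` is nonnegative.
      have hmono := monotoneOn_rpow_mul_integral_scaledCutoff ha x₀ m hv he fun x => (hL x).le
      have h := le_of_tendsto (hI x₀) (b := lam ^ ((n + 2 * a) / 2) *
        ∫ x, v x * scaledCutoff a x₀ 1 (m + 2) lam x * weight a x) (by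
          filter_upwards [Ioo_mem_nhdsGT hlam] with l hl
          exact hmono hl.1 hlam hl.2.le)
      exact nonneg_of_mul_nonneg_right h (Real.rpow_pos_of_pos hlam _)
  refine (hnn x₀).lt_of_ne fun h0 => ?_
  have hmin : IsLocalMin v x₀ := Eventually.of_forall fun x => by rw [← h0]; exact hnn x
  exact absurd (hL x₀) (not_lt.2 (hmin.negWeightedLaplacian_nonpos ha hv))

/-! ### Decay of the averages -/

theorem abs_integral_mul_scaledCutoff_le {a α : ℝ} (ha : 1 ≤ a) (hα : 0 < α)
    (x₀ : EuclideanSpace ℝ (Fin (n + 1))) {P : ℝ[X]} {m k : ℕ} (hm : m ≠ 0) (hk : k ≠ 0)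
    {C lam : ℝ} (hlam : 0 < lam) (hC0 : 0 ≤ C) (hC : ∀ t, 0 ≤ t → ∀ y, 0 ≤ y →
      y * |cutoffPoly P m t| ≤ y ^ α * cutoffPoly 1 k t / 2 + C)
    {u : EuclideanSpace ℝ (Fin (n + 1)) → ℝ} (hu : Continuous u) (hu0 : ∀ x, 0 < u x) :
    |∫ x, u x * scaledCutoff a x₀ P m lam x * weight a x| ≤
      (∫ x, u x ^ α * scaledCutoff a x₀ 1 k lam x * weight a x) / 2 + Real.pi * C *
      ∫ x in Metric.closedBall (0 : EuclideanSpace ℝ (Fin (n + 1))) (‖x₀‖ + √(1 / lam)),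
        weight a x := by
  have huα : Continuous fun x => u x ^ α := hu.rpow_const fun x => Or.inr hα.le
  have hw : Continuous (weight a : EuclideanSpace ℝ (Fin (n + 1)) → ℝ) := continuous_weight ha
  have hint : ∀ {g : EuclideanSpace ℝ (Fin (n + 1)) → ℝ}, Continuous g →
      IntegrableOn g (Metric.closedBall 0 (‖x₀‖ + √(1 / lam))) := fun hg =>
    hg.continuousOn.integrableOn_compact (isCompact_closedBall _ _)
  have hT := continuous_scaledCutoff ha x₀ P m lam
  have hT1 := continuous_scaledCutoff ha x₀ 1 k lam
  rw [← setIntegral_mul_scaledCutoff_mul_weight a x₀ P hm hlam le_rfl u,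
    ← setIntegral_mul_scaledCutoff_mul_weight a x₀ 1 hk hlam le_rfl fun x => u x ^ α]
  have hi₁ : IntegrableOn (fun x => u x ^ α * scaledCutoff a x₀ 1 k lam x * weight a x / 2)
      (Metric.closedBall 0 (‖x₀‖ + √(1 / lam))) :=
    hint (((huα.mul hT1).mul hw).div_const 2)
  have hi₂ : IntegrableOn (fun x => Real.pi * C * weight a x)
      (Metric.closedBall (0 : EuclideanSpace ℝ (Fin (n + 1))) (‖x₀‖ + √(1 / lam))) :=
    hint (continuous_const.mul hw)
  rw [← integral_div, ← integral_const_mul, ← integral_add hi₁ hi₂]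
  refine abs_integral_le_integral_abs.trans (setIntegral_mono (hint ((hu.mul hT).mul hw).abs)
    (hi₁.add hi₂)
    fun x => ?_)
  have h := mul_le_mul_of_nonneg_right (mul_abs_scaledCutoff_le ha x₀ x (α := α) hlam
    (hu0 x).le hC0 hC) (weight_nonneg a x)
  beta_reduce
  rw [abs_mul, abs_mul, abs_of_pos (hu0 x), abs_of_nonneg (weight_nonneg a x)]
  linarith

theorem tendsto_integral_iterate_mul_scaledCutoff {p : ℕ} {a α : ℝ} (ha : 1 ≤ a) (hα : 1 < α)
    {u : EuclideanSpace ℝ (Fin (n + 1)) → ℝ} (hu : ContDiff ℝ (2 * p : ℕ) u)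
    (hu0 : ∀ x, 0 < u x) (he : EvenInLast u)
    (heq : ∀ x, (negWeightedLaplacian a)^[p] u x = u x ^ α) {k : ℕ} (hkp : 2 * p + 2 ≤ k)
    (hkα : (k : ℝ) ≤ (k - 2 * p : ℕ) * α) (x₀ : EuclideanSpace ℝ (Fin (n + 1)))
    {i : ℕ} (hi : 1 ≤ i) (hip : i ≤ p) :
    Tendsto (fun lam => lam ^ ((n + 2 * a) / 2) *
      ∫ x, (negWeightedLaplacian a)^[i] u x * scaledCutoff a x₀ 1 k lam x * weight a x)
      (𝓝[>] 0) (𝓝 0) := by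
  -- After `j` transfers the power `k - 2j` of the cutoff remains; the condition `k ≤ (k - 2j) α` is
  -- most restrictive at `j = p`, which is `hkα`.
  have hstep : ∀ j ≤ p, ∃ C, 0 ≤ C ∧ ∀ lam, 0 < lam →
      |∫ x, (negWeightedLaplacian a)^[j] u x * scaledCutoff a x₀ 1 k lam x * weight a x| ≤
      lam ^ j * ((∫ x, u x ^ α * scaledCutoff a x₀ 1 k lam x * weight a x) / 2 + C *
      ∫ x in Metric.closedBall (0 : EuclideanSpace ℝ (Fin (n + 1))) (‖x₀‖ + √(1 / lam)),
        weight a x) := by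
    intro j hj
    obtain ⟨Q, hQ⟩ := exists_integral_iterate_mul_scaledCutoff (n := n) ha (k - 2 * j - 1) j 1
    rw [show k - 2 * j - 1 + 2 * j + 1 = k by omega, show k - 2 * j - 1 + 1 = k - 2 * j by omega]
      at hQ
    have hkj : (k : ℝ) ≤ (k - 2 * j : ℕ) * α := by
      refine hkα.trans (mul_le_mul_of_nonneg_right ?_ (by linarith))
      exact_mod_cast (by omega)
    obtain ⟨C, hC0, hC⟩ := exists_mul_abs_cutoffPoly_le hα Q (by omega) (by omega) hkj
    refine ⟨Real.pi * C, by positivity, fun lam hlam => ?_⟩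
    rw [hQ x₀ lam hlam u (hu.of_le (by exact_mod_cast (by omega))) he, abs_mul,
      abs_of_nonneg (by positivity)]
    gcongr
    exact abs_integral_mul_scaledCutoff_le ha (by linarith) x₀ (by omega) (by omega) hlam hC0 hC
      hu.continuous hu0
  obtain ⟨Cp, hCp0, hCp⟩ := hstep p le_rfl
  obtain ⟨Ci, hCi0, hCi⟩ := hstep i hip
  obtain ⟨V, hV0, hV⟩ := exists_setIntegral_weight_le ha x₀
  refine squeeze_zero_norm' (a := fun lam => lam * ((Cp + Ci) * V)) ?_ ?_
  · filter_upwards [Ioc_mem_nhdsGT zero_lt_one] with lam hlam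
    obtain ⟨h0, h1⟩ := hlam
    have hp := hCp lam h0
    have hi' := hCi lam h0
    have hVl := hV lam h0 h1
    simp only [heq] at hp
    set I := ∫ x, u x ^ α * scaledCutoff a x₀ 1 k lam x * weight a x with hI
    set W := ∫ x in Metric.closedBall (0 : EuclideanSpace ℝ (Fin (n + 1)))
      (‖x₀‖ + √(1 / lam)), weight a x with hW
    have hI0 : 0 ≤ I := integral_nonneg fun x => mul_nonneg (mul_nonneg
      (Real.rpow_nonneg (hu0 x).le _) (scaledCutoff_one_nonneg a x₀ x k lam)) (weight_nonneg a x)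
    have hW0 : 0 ≤ W := integral_nonneg fun x => weight_nonneg a x
    -- For `j = p` the equation makes the left side `I` itself, and `lam^p ≤ 1` allows `I / 2` to be
    -- absorbed.
    have hA : I / 2 ≤ Cp * W := by
      rw [abs_of_nonneg hI0] at hp
      have h2 : lam ^ p * (I / 2 + Cp * W) ≤ 1 * (I / 2 + Cp * W) :=
        mul_le_mul_of_nonneg_right (pow_le_one₀ h0.le h1) (by positivity)
      linarith
    -- Here `i ≥ 1` supplies the factor that forces the limit to be zero.
    have hli : lam ^ i ≤ lam := by
      simpa using pow_le_pow_of_le_one h0.le h1 hi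
    have hD : 0 ≤ lam ^ (((n : ℝ) + 2 * a) / 2) := Real.rpow_nonneg h0.le _
    rw [norm_mul, Real.norm_of_nonneg hD, Real.norm_eq_abs]
    calc _ ≤ lam ^ (((n : ℝ) + 2 * a) / 2) * (lam * ((Cp + Ci) * W)) := by
          refine mul_le_mul_of_nonneg_left (hi'.trans ?_) hD
          exact mul_le_mul hli (by linarith) (by positivity) h0.le
      _ = lam * ((Cp + Ci) * (lam ^ (((n : ℝ) + 2 * a) / 2) * W)) := by ring
      _ ≤ lam * ((Cp + Ci) * V) := by gcongr
  · have : Tendsto (fun lam : ℝ => lam * ((Cp + Ci) * V)) (𝓝 0) (𝓝 (0 * ((Cp + Ci) * V))) :=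
      tendsto_id.mul_const _
    rw [zero_mul] at this
    exact this.mono_left nhdsWithin_le_nhds

/-- With `k = N + 2p + 2` the condition reads `2p ≤ (N + 2)(α - 1)`, true for large `N` since `α >
1`. -/
theorem exists_nat_le_sub_mul (p : ℕ) {α : ℝ} (hα : 1 < α) :
    ∃ k : ℕ, 2 * p + 2 ≤ k ∧ (k : ℝ) ≤ (k - 2 * p : ℕ) * α := by
  obtain ⟨N, hN⟩ := exists_nat_ge (2 * p / (α - 1))
  refine ⟨N + 2 * p + 2, by omega, ?_⟩
  rw [show N + 2 * p + 2 - 2 * p = N + 2 by omega]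
  rw [div_le_iff₀ (by linarith)] at hN
  push_cast
  nlinarith

end WeightedLaplacian

/-! ### Descending induction on the power of the operator -/

theorem theorem1p2 (n p : ℕ) (hn : 1 ≤ n) (hp : 1 ≤ p) (a α : ℝ) (ha : 1 ≤ a) (hα : 1 < α)
    (hpn : 2 * (p : ℝ) < n + 2 * a)
    (u : EuclideanSpace ℝ (Fin (n + 1)) → ℝ)
    (hu_smooth : ContDiff ℝ ((2 * p : ℕ) : WithTop ℕ∞) u)
    (hu_pos : ∀ x, 0 < u x)
    (hu_even : WeightedLaplacian.EvenInLast u)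
    (hu_eq : ∀ x, (WeightedLaplacian.negWeightedLaplacian a)^[p] u x = u x ^ α) :
    ∀ i : ℕ, 1 ≤ i → i ≤ p - 1 →
      ∀ x, 0 < (WeightedLaplacian.negWeightedLaplacian a)^[i] u x := by
  obtain ⟨k, hkp, hkα⟩ := WeightedLaplacian.exists_nat_le_sub_mul p hα
  intro i hi hip
  refine Nat.decreasingInduction' (n := p) (P := fun i => ∀ x,
    0 < (WeightedLaplacian.negWeightedLaplacian a)^[i] u x) (fun j hjp hij ih => ?_) (by omega)
    fun x => by rw [hu_eq]; exact Real.rpow_pos_of_pos (hu_pos x) α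
  obtain ⟨h1, h2⟩ := WeightedLaplacian.contDiff_iterate_negWeightedLaplacian a j (m := 2)
    (hu_smooth.of_le (by exact_mod_cast (by omega))) hu_even
  refine WeightedLaplacian.pos_of_tendsto_integral_scaledCutoff ha (k - 2) h1 h2
    (fun x => by rw [← Function.iterate_succ_apply' (WeightedLaplacian.negWeightedLaplacian a)]
                 exact ih x) fun x₀ => ?_
  -- The positivity criterion uses the cutoff power `m + 2`, here with `m = k - 2`.
  rw [Nat.sub_add_cancel (by omega)]
  exact WeightedLaplacian.tendsto_integral_iterate_mul_scaledCutoff ha hα hu_smooth hu_pos hu_even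
    hu_eq hkp hkα x₀ (hi.trans hij) hjp.le
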